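/- Let $\mathcal L$ be a self-adjoint operator on $L^2(\Omega)$ (for instance a self-adjoint strongly elliptic differential operator on a domain $\Omega\subset\mathbb R^d$ with homogeneous boundary conditions, which are encoded in its domain), with simple positive eigenvalues $0<\mu_1<\mu_2<\cdots$ and eigenfunctions $\phi_1,\phi_2,\dots$ that form a complete orthonormal basis of $L^2(\Omega)$. Assume that $\mu_n=Mn^{\beta}(1+o(n^{-\sigma}))$ with $M>0$, $\beta>1$, $\sigma\in(0,1]$, and that $\mu_{n+1}-\mu_n\ge\theta n^{-s}$ for all $n\ge1$, with $\theta>0$, $s\ge0$. For $0<T\le\infty$ let $d_n(T)$ be the distance in $L^2[0,T]$ (in $L^2[0,\infty)$ if $T=\infty$) from $e^{-\mu_nt}$ to the closed span of $\{e^{-\mu_kt}:k\ne n\}$. Then for every $0<T<\infty$ there is $\kappa(T)>0$ with $d_n(T)\ge\kappa(T)^{-1}d_n(\infty)$ for all $n\ge 1$, and the following holds. Let $p\ge0$ and $\alpha\in[0,\beta)$. Let $g=\sum_{n\ge1}c_n\phi_n$ (possibly a formal series) with $|c_n|\ge Ce^{-pn^{\alpha}}$ for all $n\ge 1$ and some $C>0$,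 and let $f\in L^2(\Omega)$. Let $u$ and $w$ be the solutions for $t>0$ of $\partial_tu=-\mathcal Lu$ with initial data $g$ and $f$ (attained coefficientwise in the basis $(\phi_n)$ as $t\to0^+$), let $0\le t_0<t_1$, and assume that $g\in L^2(\Omega)$ or, more generally, that $u\in L^2(t_0,t_1;L^2(\Omega))$. Then for every $\tau>t_0$ there is $\nu=\nu(\cdot\,;\tau)\in L^2[t_0,t_1]$ such that $$w(\cdot,\tau)=\int_{t_0}^{t_1}u(\cdot,t)\,\nu(t)\,dt ,$$ where the integrand is Bochner integrable in $L^2(\Omega)$, and such that for all $\delta\in(0,\beta-\max(\alpha,1))$ and $r\in(0,1)$, if $\tau-t_0\le r$, then $$\|\nu\|_{L^2[t_0,t_1]}\le\frac{1}{\sqrt2\,C}\,\kappa(t_1-t_0)\,\|f\|_{L^2(\Omega)}\,(\tau-t_0)^{-\omega(\tau-t_0)/2},\qquad \omega(t)=1+\varpi\,t^{-\frac{\max(\alpha,1)}{\beta-\max(\alpha,1)-\delta}} .$$ Here $\kappa(t_1-t_0)$ may be any constant with the property above for $T=t_1-t_0$, and the constant $\varpi$ depends only on $(\mu_n)_{n\ge1}$,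 $p$, $\alpha$, $\delta$ and $r$; in particular it does not depend on $C,g,f,t_0,t_1,\tau$. -/

import Mathlib

open MeasureTheory Set Filter Topology Asymptotics

/-- `μ` and `φ` are the eigenvalues and eigenfunctions of the self-adjoint operator `L` on
`L²(Ω)`: the eigenvalues are positive, simple and listed in increasing order, and the
eigenfunctions form a complete orthonormal basis. Sequences that are indexed by `1, 2, …` on paper
are indexed by `0, 1, …` here, so that `μ n`, `φ n` stand for the `(n + 1)`-st entries. -/
structure IsSimpleEigensystem {𝕜 : Type*} [RCLike 𝕜] {Ω : Type*} [MeasurableSpace Ω]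
    {m : Measure Ω} (L : Lp 𝕜 2 m →ₗ.[𝕜] Lp 𝕜 2 m) (μ : ℕ → ℝ)
    (φ : HilbertBasis ℕ 𝕜 (Lp 𝕜 2 m)) : Prop where
  selfAdjoint : IsSelfAdjoint L
  pos : ∀ n, 0 < μ n
  strictMono : StrictMono μ
  eigen : ∀ n, ∃ h : φ n ∈ L.domain, L ⟨φ n, h⟩ = (μ n : 𝕜) • φ n

/-- `u` solves `∂ₜ u = - L u` for `t > 0` (the boundary condition is part of the domain of `L`),
with the initial datum `∑ cₙ φₙ`. The datum may be a formal series that does not converge in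
`L²(Ω)`, so it is attained coefficient by coefficient as `t → 0⁺`. -/
structure IsEvolutionSolution {𝕜 : Type*} [RCLike 𝕜] {Ω : Type*} [MeasurableSpace Ω]
    {m : Measure Ω} (L : Lp 𝕜 2 m →ₗ.[𝕜] Lp 𝕜 2 m) (φ : HilbertBasis ℕ 𝕜 (Lp 𝕜 2 m))
    (c : ℕ → 𝕜) (u : ℝ → Lp 𝕜 2 m) : Prop where
  equation : ∀ t : ℝ, 0 < t → ∃ h : u t ∈ L.domain, HasDerivAt u (-(L ⟨u t, h⟩)) t
  initial : ∀ n, Tendsto (fun t => φ.repr (u t) n) (𝓝[>] 0) (𝓝 (c n))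

/-- Growth of the eigenvalues: `μₙ = M n^β (1 + o(n^{-σ}))`, with `β > 1` and `σ ∈ (0, 1]`. -/
def EigenvalueGrowth (μ : ℕ → ℝ) (M β σ : ℝ) : Prop :=
  0 < M ∧ 1 < β ∧ 0 < σ ∧ σ ≤ 1 ∧
    (fun n : ℕ => μ n / (M * ((n : ℝ) + 1) ^ β) - 1) =o[atTop]
      (fun n : ℕ => ((n : ℝ) + 1) ^ (-σ))

/-- Gaps of the eigenvalues: `μₙ₊₁ - μₙ ≥ θ n^{-s}` for all `n`, with `θ > 0` and `s ≥ 0`. -/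
def EigenvalueGap (μ : ℕ → ℝ) (θ s : ℝ) : Prop :=
  0 < θ ∧ 0 ≤ s ∧ ∀ n : ℕ, θ * ((n : ℝ) + 1) ^ (-s) ≤ μ (n + 1) - μ n

/-- The distance in `L²(I)` from `e^{-μₙ t}` to the linear span of the `e^{-μₖ t}` with `k ≠ n`
(equivalently, to the closure of that span). -/
noncomputable def expDist (μ : ℕ → ℝ) (I : Set ℝ) (n : ℕ) : ℝ :=
  ⨅ a : {a : ℕ →₀ ℝ // a n = 0},
    Real.sqrt (∫ t in I,
      (Real.exp (-(μ n) * t) - a.1.sum fun k x => x * Real.exp (-(μ k) * t)) ^ 2)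

/-- `κ` compares the distances on `[0, T]` with those on `[0, ∞)`:
`dₙ(T) ≥ κ⁻¹ dₙ(∞)` for all `n`. -/
def IsDistComparison (μ : ℕ → ℝ) (T κ : ℝ) : Prop :=
  0 < κ ∧ ∀ n, κ⁻¹ * expDist μ (Ici 0) n ≤ expDist μ (Icc 0 T) n

/-- The exponent `ω(t) = 1 + ϖ t^{- max(α, 1) / (β - max(α, 1) - δ)}`. -/
noncomputable def omegaExp (α β δ ϖ t : ℝ) : ℝ :=
  1 + ϖ * t ^ (-(max α 1 / (β - max α 1 - δ)))

/-!
In the basis of eigenfunctions the representation `w(τ) = ∫ u ν` is the moment problem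
`cₙ ∫ ν(t) e^{-μₙ t} dt = fₙ e^{-μₙ τ}`. It is solved by `ν = ∑ (fₙ / cₙ) e^{-μₙ τ} qₙ`, where
`(qₙ)` is biorthogonal to the exponentials on `(t₀, t₁)`. Taking for `qₙ` a multiple of the residual
of the orthogonal projection of `e^{-μₙ t}` to the closed span of the other exponentials gives
`‖qₙ‖ ≤ e^{μₙ t₀} / dₙ(t₁ - t₀)` (`exists_biorthogonal`), so everything rests on lower bounds of the
distances.

On the half line, the Gram matrix of the exponentials is `1 / (μᵢ + μₖ)`, and multiplying the
coefficient of the `k`-th exponential by `(μₖ - μⱼ) / (μₖ + μⱼ)` decreases the Gram form by a square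
(`gram_mul_ratio_le`). These contractions are diagonal, and the `j`-th one annihilates the `j`-th
exponential. Applying all of them with `j ≠ n` bounds `dₙ(∞)` from below by
`(2 μₙ)^{-1/2} ∏ |μₙ - μⱼ| / (μₙ + μⱼ)`, and growth and gaps of the eigenvalues bound the product from
below by `exp (-K n^b)`, for every `b > 1` (`exists_prod_ratio_le_exp`).

It follows that the coefficients of an exponential sum are at most
`√(2 μₙ) exp (K n^b)` times its norm on the half line. For `b < β` this makes bounded sets
of exponential sums precompact away from `t = 0`, with limits that are analytic. A sequence of
normalized sums that tends to zero on `(0, T)` would thus tend to zero on `(T, ∞)` as well, which is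
impossible; this is the comparison of `dₙ(T)` with `dₙ(∞)`
(`exists_integral_Ici_le_mul_integral_Icc`).

By the Cauchy–Schwarz inequality, the norm of `ν` is bounded by `κ ‖f‖ / C` times the square root of
`∑ 2 μₙ exp (2 (K + p) n^b - 2 μₙ h)` with `h = τ - t₀`. The sum is at most
`(4 / h) exp (A h^{-b / (β - b)})` (`exists_tsum_weight_le`). The room given by `δ` permits the choice
`b = max(α, 1) β / (β - δ) > 1`, for which the power of `h` is the one in the claim, and `h ≤ r < 1`
turns the exponential into a power of `h` (`exists_sqrt_exp_le_rpow`).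
-/

/-! ### Size of the eigenvalues and of the Blaschke-type products -/

theorem EigenvalueGrowth.exists_two_sided_bound {μ : ℕ → ℝ} {M β σ : ℝ}
    (h : EigenvalueGrowth μ M β σ) (hpos : ∀ n, 0 < μ n) :
    ∃ c C : ℝ, 0 < c ∧ 0 < C ∧ ∀ n : ℕ,
      c * ((n : ℝ) + 1) ^ β ≤ μ n ∧ μ n ≤ C * ((n : ℝ) + 1) ^ β := by
  obtain ⟨hM, -, hσ, -, ho⟩ := h
  have hx : ∀ n : ℕ, (0 : ℝ) < M * ((n : ℝ) + 1) ^ β := fun n => by positivity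
  have h0 : Tendsto (fun n : ℕ => ((n : ℝ) + 1) ^ (-σ)) atTop (𝓝 0) :=
    (tendsto_rpow_neg_atTop hσ).comp
      (tendsto_atTop_add_const_right _ _ tendsto_natCast_atTop_atTop)
  have h1 : Tendsto (fun n : ℕ => μ n / (M * ((n : ℝ) + 1) ^ β)) atTop (𝓝 1) := by
    simpa using (ho.trans_tendsto h0).add_const 1
  have h2 : Tendsto (fun n : ℕ => (μ n / (M * ((n : ℝ) + 1) ^ β))⁻¹) atTop (𝓝 1) := by
    simpa using h1.inv₀ one_ne_zero
  obtain ⟨A, hA⟩ := h1.bddAbove_range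
  obtain ⟨B, hB⟩ := h2.bddAbove_range
  have hA' : ∀ n, μ n / (M * ((n : ℝ) + 1) ^ β) ≤ A := fun n => hA ⟨n, rfl⟩
  have hB' : ∀ n, (μ n / (M * ((n : ℝ) + 1) ^ β))⁻¹ ≤ B := fun n => hB ⟨n, rfl⟩
  have hAp : 0 < A := (div_pos (hpos 0) (hx 0)).trans_le (hA' 0)
  have hBp : 0 < B := (inv_pos.2 (div_pos (hpos 0) (hx 0))).trans_le (hB' 0)
  refine ⟨M / B, A * M, by positivity, by positivity, fun n => ⟨?_, ?_⟩⟩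
  · have := hB' n
    rw [inv_div, div_le_iff₀ (hpos n)] at this
    rw [div_mul_eq_mul_div, div_le_iff₀ hBp]
    linarith
  · have := hA' n
    rw [div_le_iff₀ (hx n)] at this
    linarith

/-- The gap between two neighbours bounds from below the distance of any two eigenvalues up to a
given index. -/
theorem EigenvalueGap.le_abs_sub {μ : ℕ → ℝ} {θ s : ℝ} (h : EigenvalueGap μ θ s)
    (hmono : StrictMono μ) {n k : ℕ} (hnk : k ≠ n) {y : ℝ} (hn : (n : ℝ) + 1 ≤ y)
    (hk : (k : ℝ) + 1 ≤ y) : θ * y ^ (-s) ≤ |μ n - μ k| := by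
  obtain ⟨hθ, hs, hgap⟩ := h
  have key : ∀ i j : ℕ, i < j → (i : ℝ) + 1 ≤ y → θ * y ^ (-s) ≤ μ j - μ i := by
    intro i j hij hi
    have h1 : μ (i + 1) ≤ μ j := hmono.monotone hij
    have h2 : y ^ (-s) ≤ ((i : ℝ) + 1) ^ (-s) :=
      Real.rpow_le_rpow_of_nonpos (by positivity) hi (by linarith)
    nlinarith [hgap i, mul_le_mul_of_nonneg_left h2 hθ.le]
  rcases lt_or_gt_of_ne hnk with hlt | hlt
  · exact (key k n hlt hk).trans (le_abs_self _)
  · rw [abs_sub_comm]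
    exact (key n k hlt hn).trans (le_abs_self _)

/-- Growth of the products that are reciprocal to the distances on the half line. Indices `k`
with `k + 1 < B (n + 1)` contribute at most a power of `n + 1` each; the remaining ones contribute
`exp (O(μ n / μ k))`, which is summable. -/
theorem exists_prod_ratio_le_exp {μ : ℕ → ℝ} {M β σ θ s : ℝ} (hpos : ∀ n, 0 < μ n)
    (hmono : StrictMono μ) (hgrowth : EigenvalueGrowth μ M β σ) (hgap : EigenvalueGap μ θ s)
    {b : ℝ} (hb : 1 < b) :
    ∃ K : ℝ, 0 ≤ K ∧ ∀ (n : ℕ) (S : Finset ℕ), n ∉ S →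
      ∏ k ∈ S, (μ n + μ k) / |μ n - μ k| ≤ Real.exp (K * ((n : ℝ) + 1) ^ b) := by
  obtain ⟨c, C, hc, hC, hcC⟩ := hgrowth.exists_two_sided_bound hpos
  have hβ : 1 < β := hgrowth.2.1
  have hθ := hgap.1
  have hs := hgap.2.1
  obtain ⟨B, hB1, hB⟩ : ∃ B : ℕ, 1 ≤ B ∧ 2 * C / c ≤ (B : ℝ) ^ β := by
    obtain ⟨B, hB⟩ := exists_nat_ge (max 1 (2 * C / c))
    have h1 : (1 : ℝ) ≤ B := (le_max_left _ _).trans hB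
    refine ⟨B, by exact_mod_cast h1, ((le_max_right _ _).trans hB).trans ?_⟩
    simpa using Real.rpow_le_rpow_of_exponent_le h1 hβ.le
  have hBp : (0 : ℝ) < B := by exact_mod_cast hB1
  -- an exponent for which `(x / y)^β ≤ (x / y)^b' ≤ x^b y^{-b'}` when `1 ≤ x ≤ y`
  set b' := min b β with hb'
  have hb'1 : 1 < b' := lt_min hb hβ
  have hsum : Summable fun k : ℕ => ((k : ℝ) + 1) ^ (-b') := by
    have := (summable_nat_add_iff 1).2 (Real.summable_nat_rpow.2 (by linarith : -b' < -1))
    simpa using this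
  set Z := ∑' k : ℕ, ((k : ℝ) + 1) ^ (-b') with hZ
  have hZ0 : 0 ≤ Z := tsum_nonneg fun k => by positivity
  set A := max 1 ((C + C * (B : ℝ) ^ β) / (θ * (B : ℝ) ^ (-s))) with hA
  have hA1 : 1 ≤ A := le_max_left _ _
  set A' := Real.log A + (β + s) / (b - 1) with hA'
  have hA'0 : 0 ≤ A' := add_nonneg (Real.log_nonneg hA1) (div_nonneg (by linarith) (by linarith))
  refine ⟨A' * B + 4 * (C / c) * Z, by positivity, fun n S hnS => ?_⟩
  set x : ℝ := (n : ℝ) + 1 with hx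
  have hx1 : 1 ≤ x := by simp [hx]
  have hxp : 0 < x := by linarith
  have hterm0 : ∀ k, 0 ≤ (μ n + μ k) / |μ n - μ k| := fun k =>
    div_nonneg (by linarith [hpos n, hpos k]) (abs_nonneg _)
  -- near indices: the denominator is bounded below by the gap condition, which costs a power of `x`
  have hnear : ∀ k ∈ S.filter (fun k => k < B * (n + 1)),
      (μ n + μ k) / |μ n - μ k| ≤ Real.exp (A' * x ^ (b - 1)) := by
    intro k hk
    obtain ⟨hkS, hkB⟩ := Finset.mem_filter.1 hk
    have hkn : k ≠ n := fun h => hnS (h ▸ hkS)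
    have hky : (k : ℝ) + 1 ≤ B * x := by
      have : ((k + 1 : ℕ) : ℝ) ≤ ((B * (n + 1) : ℕ) : ℝ) := by exact_mod_cast hkB
      push_cast at this
      exact this
    have hny : (n : ℝ) + 1 ≤ B * x := by
      have : (1 : ℝ) ≤ B := by exact_mod_cast hB1
      nlinarith
    have h1 := hgap.le_abs_sub hmono hkn hny hky
    have hBx : 0 < θ * ((B : ℝ) * x) ^ (-s) := by positivity
    have h2 : μ n + μ k ≤ (C + C * (B : ℝ) ^ β) * x ^ β := by
      have h3 : ((k : ℝ) + 1) ^ β ≤ (B * x) ^ β :=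
        Real.rpow_le_rpow (by positivity) hky (by linarith)
      rw [Real.mul_rpow hBp.le hxp.le] at h3
      have := (hcC n).2
      have := (hcC k).2
      nlinarith [mul_le_mul_of_nonneg_left h3 hC.le]
    have h4 : (μ n + μ k) / |μ n - μ k| ≤ A * x ^ (β + s) := by
      calc (μ n + μ k) / |μ n - μ k|
          ≤ ((C + C * (B : ℝ) ^ β) * x ^ β) / (θ * ((B : ℝ) * x) ^ (-s)) :=
            div_le_div₀ (by positivity) h2 hBx h1
        _ = ((C + C * (B : ℝ) ^ β) / (θ * (B : ℝ) ^ (-s))) * x ^ (β + s) := by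
            rw [Real.mul_rpow hBp.le hxp.le, Real.rpow_add hxp, Real.rpow_neg hxp.le]
            field_simp
        _ ≤ A * x ^ (β + s) := by gcongr; exact le_max_right _ _
    refine h4.trans ?_
    have hA_exp : A * x ^ (β + s) = Real.exp (Real.log A + Real.log x * (β + s)) := by
      rw [Real.exp_add, Real.exp_log (zero_lt_one.trans_le hA1), Real.rpow_def_of_pos hxp]
    rw [hA_exp]
    apply Real.exp_le_exp.2
    have h5 : Real.log x ≤ x ^ (b - 1) / (b - 1) := Real.log_le_rpow_div hxp.le (by linarith)
    have h6 : 1 ≤ x ^ (b - 1) := Real.one_le_rpow hx1 (by linarith)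
    have h7 : Real.log A ≤ Real.log A * x ^ (b - 1) :=
      le_mul_of_one_le_right (Real.log_nonneg hA1) h6
    have h8 := mul_le_mul_of_nonneg_right h5 (by linarith : 0 ≤ β + s)
    have h9 : x ^ (b - 1) / (b - 1) * (β + s) = (β + s) / (b - 1) * x ^ (b - 1) := by ring
    rw [hA', add_mul]
    linarith
  -- far indices: `μ k ≥ 2 μ n` by the choice of `B`
  have hfar : ∀ k ∈ S.filter (fun k => ¬ k < B * (n + 1)),
      (μ n + μ k) / |μ n - μ k| ≤ Real.exp (4 * (C / c) * x ^ b * ((k : ℝ) + 1) ^ (-b')) := by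
    intro k hk
    obtain ⟨-, hkB⟩ := Finset.mem_filter.1 hk
    have hky : (B : ℝ) * x ≤ (k : ℝ) + 1 := by
      have : ((B * (n + 1) : ℕ) : ℝ) ≤ ((k + 1 : ℕ) : ℝ) := by
        exact_mod_cast (by omega : B * (n + 1) ≤ k + 1)
      push_cast at this
      exact this
    set y : ℝ := (k : ℝ) + 1
    have hyp : 0 < y := lt_of_lt_of_le (by positivity) hky
    have hxy : x ≤ y := by
      have : (1 : ℝ) ≤ B := by exact_mod_cast hB1
      nlinarith
    have h1 : 2 * μ n ≤ μ k := by
      have h2 : (B * x) ^ β ≤ y ^ β := Real.rpow_le_rpow (by positivity) hky (by linarith)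
      rw [Real.mul_rpow hBp.le hxp.le] at h2
      rw [div_le_iff₀ hc] at hB
      have h3 := mul_le_mul_of_nonneg_right hB (by positivity : 0 ≤ x ^ β)
      have := (hcC n).2
      have := (hcC k).1
      nlinarith [mul_le_mul_of_nonneg_left h2 hc.le]
    have h4 : (μ n + μ k) / |μ n - μ k| ≤ 4 * (μ n / μ k) + 1 := by
      have h5 := hpos n
      rw [abs_sub_comm, abs_of_pos (by linarith), div_le_iff₀ (by linarith)]
      have h6 : μ n / μ k * μ k = μ n := div_mul_cancel₀ _ (by linarith)
      have h7 : μ n / μ k ≤ 1 / 2 := by rw [div_le_iff₀ (by linarith)]; linarith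
      nlinarith
    have h5 : μ n / μ k ≤ C / c * (x ^ b * y ^ (-b')) := by
      calc μ n / μ k ≤ (C * x ^ β) / (c * y ^ β) :=
            div_le_div₀ (by positivity) (hcC n).2 (by positivity) (hcC k).1
        _ = C / c * (x / y) ^ β := by rw [Real.div_rpow hxp.le hyp.le]; field_simp
        _ ≤ C / c * (x / y) ^ b' := by
            refine mul_le_mul_of_nonneg_left ?_ (by positivity)
            exact Real.rpow_le_rpow_of_exponent_ge (by positivity)
              ((div_le_one hyp).2 hxy) (min_le_right _ _)
        _ = C / c * (x ^ b' * y ^ (-b')) := by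
            rw [Real.div_rpow hxp.le hyp.le, Real.rpow_neg hyp.le, div_eq_mul_inv (x ^ b')]
        _ ≤ C / c * (x ^ b * y ^ (-b')) := by
            gcongr
            exact min_le_left _ _
    refine h4.trans ((Real.add_one_le_exp _).trans (Real.exp_le_exp.2 ?_))
    linarith
  rw [← Finset.prod_filter_mul_prod_filter_not S (fun k => k < B * (n + 1)), add_mul,
    Real.exp_add]
  refine mul_le_mul ?_ ?_ (Finset.prod_nonneg fun k _ => hterm0 k) (Real.exp_pos _).le
  · refine (Finset.prod_le_prod (fun k _ => hterm0 k) hnear).trans ?_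
    rw [Finset.prod_const, ← Real.exp_nat_mul]
    apply Real.exp_le_exp.2
    have hcard : ((S.filter (fun k => k < B * (n + 1))).card : ℝ) ≤ B * x := by
      have : (S.filter (fun k => k < B * (n + 1))).card ≤ (Finset.range (B * (n + 1))).card :=
        Finset.card_le_card fun k hk => Finset.mem_range.2 (Finset.mem_filter.1 hk).2
      rw [Finset.card_range] at this
      have := (Nat.cast_le (α := ℝ)).2 this
      push_cast at this
      exact this
    have h1 : x ^ b = x * x ^ (b - 1) := by
      rw [← Real.rpow_one_add' hxp.le (by linarith)]; congr 1; ring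
    calc _ ≤ B * x * (A' * x ^ (b - 1)) := by gcongr
      _ = _ := by rw [h1]; ring
  · refine (Finset.prod_le_prod (fun k _ => hterm0 k) hfar).trans ?_
    rw [← Real.exp_sum, ← Finset.mul_sum]
    apply Real.exp_le_exp.2
    have : ∑ k ∈ S.filter (fun k => ¬ k < B * (n + 1)), ((k : ℝ) + 1) ^ (-b') ≤ Z :=
      hsum.sum_le_tsum _ fun k _ => by positivity
    calc _ ≤ 4 * (C / c) * x ^ b * Z := by gcongr
      _ = _ := by ring

/-! ### The Gram form of real exponentials on the half line -/

/-- Multiplying the coefficient of `e^{-μₖ t}` by `(μₖ - λ) / (μₖ + λ)` is a contraction of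
`L²(0, ∞)`: the two Gram forms differ by `2 λ (∑ aₖ / (μₖ + λ))²`. -/
theorem gram_mul_ratio_le {μ : ℕ → ℝ} (hpos : ∀ n, 0 < μ n) (S : Finset ℕ) (a : ℕ → ℝ)
    {l : ℝ} (hl : 0 < l) :
    ∑ i ∈ S, ∑ k ∈ S, ((μ i - l) / (μ i + l) * a i) * ((μ k - l) / (μ k + l) * a k) / (μ i + μ k)
      ≤ ∑ i ∈ S, ∑ k ∈ S, a i * a k / (μ i + μ k) := by
  have key : ∑ i ∈ S, ∑ k ∈ S, a i * a k / (μ i + μ k) -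
      ∑ i ∈ S, ∑ k ∈ S,
        ((μ i - l) / (μ i + l) * a i) * ((μ k - l) / (μ k + l) * a k) / (μ i + μ k)
      = 2 * l * (∑ i ∈ S, a i / (μ i + l)) ^ 2 := by
    rw [sq, Finset.sum_mul_sum, Finset.mul_sum, ← Finset.sum_sub_distrib]
    refine Finset.sum_congr rfl fun i _ => ?_
    rw [Finset.mul_sum, ← Finset.sum_sub_distrib]
    refine Finset.sum_congr rfl fun k _ => ?_
    have h1 : μ i + l ≠ 0 := by linarith [hpos i]
    have h2 : μ k + l ≠ 0 := by linarith [hpos k]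
    have h3 : μ i + μ k ≠ 0 := by linarith [hpos i, hpos k]
    field_simp
    ring
  nlinarith [sq_nonneg (∑ i ∈ S, a i / (μ i + l))]

theorem gram_mul_prod_ratio_le {μ : ℕ → ℝ} (hpos : ∀ n, 0 < μ n) (S J : Finset ℕ) (a : ℕ → ℝ) :
    ∑ i ∈ S, ∑ k ∈ S, ((∏ j ∈ J, (μ i - μ j) / (μ i + μ j)) * a i) *
        ((∏ j ∈ J, (μ k - μ j) / (μ k + μ j)) * a k) / (μ i + μ k)
      ≤ ∑ i ∈ S, ∑ k ∈ S, a i * a k / (μ i + μ k) := by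
  induction J using Finset.induction_on with
  | empty => simp
  | insert j J hj ih =>
    refine le_trans ?_ ih
    refine le_trans (le_of_eq ?_) (gram_mul_ratio_le hpos S
      (fun i => (∏ j ∈ J, (μ i - μ j) / (μ i + μ j)) * a i) (hpos j))
    refine Finset.sum_congr rfl fun i _ => Finset.sum_congr rfl fun k _ => ?_
    rw [Finset.prod_insert hj, Finset.prod_insert hj]
    ring

/-- Annihilating all exponentials but the `n`-th one by the contractions of `gram_mul_ratio_le`
leaves a lower bound of the Gram form by the `n`-th coefficient. -/
theorem sq_div_le_gram {μ : ℕ → ℝ} (hpos : ∀ n, 0 < μ n) (S : Finset ℕ) (a : ℕ → ℝ)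
    {n : ℕ} (hn : n ∈ S) :
    ((∏ j ∈ S.erase n, (μ n - μ j) / (μ n + μ j)) * a n) ^ 2 / (2 * μ n)
      ≤ ∑ i ∈ S, ∑ k ∈ S, a i * a k / (μ i + μ k) := by
  refine le_trans (le_of_eq ?_) (gram_mul_prod_ratio_le hpos S (S.erase n) a)
  have h0 : ∀ i ∈ S, i ≠ n → ∏ j ∈ S.erase n, (μ i - μ j) / (μ i + μ j) = 0 := fun i hi hin =>
    Finset.prod_eq_zero (Finset.mem_erase.2 ⟨hin, hi⟩) (by simp)
  rw [Finset.sum_eq_single_of_mem n hn, Finset.sum_eq_single_of_mem n hn]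
  · rw [sq, two_mul]
  · intro k hk hkn
    rw [h0 k hk hkn]; simp
  · intro k hk hkn
    rw [h0 k hk hkn]; simp

/-! ### Exponential sums -/

/-- The exponential sum `∑ aₖ e^{-μₖ t}` with finitely many terms. -/
noncomputable def expSum (μ : ℕ → ℝ) (a : ℕ →₀ ℝ) (t : ℝ) : ℝ :=
  a.sum fun k x => x * Real.exp (-(μ k) * t)

theorem continuous_expSum (μ : ℕ → ℝ) (a : ℕ →₀ ℝ) : Continuous (expSum μ a) := by
  unfold expSum Finsupp.sum
  fun_prop

theorem expSum_sq (μ : ℕ → ℝ) (a : ℕ →₀ ℝ) (t : ℝ) :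
    expSum μ a t ^ 2 =
      ∑ i ∈ a.support, ∑ k ∈ a.support, a i * a k * Real.exp (-(μ i + μ k) * t) := by
  rw [expSum, Finsupp.sum, sq, Finset.sum_mul_sum]
  refine Finset.sum_congr rfl fun i _ => Finset.sum_congr rfl fun k _ => ?_
  rw [show -(μ i + μ k) * t = -(μ i) * t + -(μ k) * t by ring, Real.exp_add]
  ring

theorem integrableOn_expSum_sq {μ : ℕ → ℝ} (hpos : ∀ n, 0 < μ n) (a : ℕ →₀ ℝ) :
    IntegrableOn (fun t => expSum μ a t ^ 2) (Ici 0) := by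
  rw [integrableOn_Ici_iff_integrableOn_Ioi]
  simp only [expSum_sq]
  refine integrable_finsetSum _ fun i _ => integrable_finsetSum _ fun k _ => ?_
  exact (integrableOn_exp_mul_Ioi (by linarith [hpos i, hpos k]) 0).const_mul _

theorem integral_expSum_sq {μ : ℕ → ℝ} (hpos : ∀ n, 0 < μ n) (a : ℕ →₀ ℝ) :
    ∫ t in Ici (0 : ℝ), expSum μ a t ^ 2 =
      ∑ i ∈ a.support, ∑ k ∈ a.support, a i * a k / (μ i + μ k) := by
  have hint : ∀ i k, IntegrableOn (fun t => a i * a k * Real.exp (-(μ i + μ k) * t)) (Ioi 0) :=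
    fun i k => (integrableOn_exp_mul_Ioi (by linarith [hpos i, hpos k]) 0).const_mul _
  rw [integral_Ici_eq_integral_Ioi]
  simp only [expSum_sq]
  rw [integral_finsetSum _ fun i _ => integrable_finsetSum _ fun k _ => hint i k]
  refine Finset.sum_congr rfl fun i _ => ?_
  rw [integral_finsetSum _ fun k _ => hint i k]
  refine Finset.sum_congr rfl fun k _ => ?_
  rw [integral_const_mul, integral_exp_mul_Ioi (by linarith [hpos i, hpos k])]
  rw [mul_zero, Real.exp_zero, neg_div_neg_eq, mul_one_div]

/-- The weights `√(2 μₙ) e^{K (n + 1)^b}` that dominate the reciprocals of the distances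
on the half line. -/
noncomputable def expWeight (μ : ℕ → ℝ) (K b : ℝ) (n : ℕ) : ℝ :=
  Real.sqrt (2 * μ n) * Real.exp (K * ((n : ℝ) + 1) ^ b)

theorem expWeight_pos {μ : ℕ → ℝ} (hpos : ∀ n, 0 < μ n) (K b : ℝ) (n : ℕ) :
    0 < expWeight μ K b n :=
  mul_pos (Real.sqrt_pos.2 (by linarith [hpos n])) (Real.exp_pos _)

/-- Every coefficient of an exponential sum is controlled by the norm in `L²(0, ∞)`. -/
theorem exists_abs_coeff_le {μ : ℕ → ℝ} {M β σ θ s : ℝ} (hpos : ∀ n, 0 < μ n)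
    (hmono : StrictMono μ) (hgrowth : EigenvalueGrowth μ M β σ) (hgap : EigenvalueGap μ θ s)
    {b : ℝ} (hb : 1 < b) :
    ∃ K : ℝ, 0 ≤ K ∧ ∀ (a : ℕ →₀ ℝ) (n : ℕ),
      |a n| ≤ expWeight μ K b n * Real.sqrt (∫ t in Ici (0 : ℝ), expSum μ a t ^ 2) := by
  obtain ⟨K, hK, hprod⟩ := exists_prod_ratio_le_exp hpos hmono hgrowth hgap hb
  refine ⟨K, hK, fun a n => ?_⟩
  by_cases hn : n ∈ a.support
  swap
  · rw [Finsupp.notMem_support_iff.1 hn, abs_zero]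
    exact mul_nonneg (expWeight_pos hpos K b n).le (Real.sqrt_nonneg _)
  have h1 := sq_div_le_gram hpos a.support a hn
  rw [← integral_expSum_sq hpos a] at h1
  have h2 := hprod n (a.support.erase n) (Finset.notMem_erase _ _)
  set Q := ∫ t in Ici (0 : ℝ), expSum μ a t ^ 2
  set P := ∏ j ∈ a.support.erase n, (μ n - μ j) / (μ n + μ j) with hP
  have hPne : ∀ j ∈ a.support.erase n, 0 < |μ n - μ j| := fun j hj =>
    abs_pos.2 (sub_ne_zero.2 fun h => (Finset.mem_erase.1 hj).1 (hmono.injective h).symm)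
  have hP1 : ∏ k ∈ a.support.erase n, (μ n + μ k) / |μ n - μ k| = |P|⁻¹ := by
    rw [hP, Finset.abs_prod, ← Finset.prod_inv_distrib]
    refine Finset.prod_congr rfl fun k _ => ?_
    rw [abs_div, inv_div, abs_of_pos (add_pos (hpos n) (hpos k))]
  have hP0 : 0 < |P| := by
    rw [hP, Finset.abs_prod]
    refine Finset.prod_pos fun k hk => ?_
    rw [abs_div]
    exact div_pos (hPne k hk) (abs_pos.2 (add_pos (hpos n) (hpos k)).ne')
  rw [hP1] at h2
  have h3 : |P| * |a n| ≤ Real.sqrt (2 * μ n) * Real.sqrt Q := by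
    rw [← abs_mul, ← Real.sqrt_mul (by linarith [hpos n])]
    apply Real.abs_le_sqrt
    rw [div_le_iff₀ (by linarith [hpos n])] at h1
    linarith
  calc |a n| = |P|⁻¹ * (|P| * |a n|) := by field_simp
    _ ≤ Real.exp (K * ((n : ℝ) + 1) ^ b) * (Real.sqrt (2 * μ n) * Real.sqrt Q) :=
        mul_le_mul h2 h3 (by positivity) (Real.exp_pos _).le
    _ = _ := by rw [expWeight]; ring

/-- The sums over which the infimum in `expDist` is taken are the exponential sums whose `n`-th
coefficient is `1`. -/
theorem exp_sub_sum_eq_expSum (μ : ℕ → ℝ) (n : ℕ) (a : ℕ →₀ ℝ) (t : ℝ) :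
    Real.exp (-(μ n) * t) - a.sum (fun k x => x * Real.exp (-(μ k) * t)) =
      expSum μ (Finsupp.single n 1 - a) t := by
  rw [expSum, Finsupp.sum_sub_index (by intros; ring), Finsupp.sum_single_index (by ring), one_mul]

theorem expDist_le (μ : ℕ → ℝ) (I : Set ℝ) (n : ℕ) {a : ℕ →₀ ℝ} (ha : a n = 0) :
    expDist μ I n ≤ Real.sqrt (∫ t in I,
      (Real.exp (-(μ n) * t) - a.sum fun k x => x * Real.exp (-(μ k) * t)) ^ 2) :=
  ciInf_le (f := fun a : {a : ℕ →₀ ℝ // a n = 0} => Real.sqrt (∫ t in I,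
      (Real.exp (-(μ n) * t) - a.1.sum fun k x => x * Real.exp (-(μ k) * t)) ^ 2))
    ⟨0, by rintro _ ⟨a, rfl⟩; exact Real.sqrt_nonneg _⟩ ⟨a, ha⟩

theorem le_expDist {μ : ℕ → ℝ} {I : Set ℝ} {n : ℕ} {d : ℝ}
    (h : ∀ a : ℕ →₀ ℝ, a n = 1 → d ≤ Real.sqrt (∫ t in I, expSum μ a t ^ 2)) :
    d ≤ expDist μ I n := by
  have : Nonempty {a : ℕ →₀ ℝ // a n = 0} := ⟨⟨0, rfl⟩⟩
  refine le_ciInf fun a => ?_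
  simp only [exp_sub_sum_eq_expSum]
  exact h _ (by simp [a.2])

/-! ### Weighted sums over the spectrum -/

/-- The exponent `2 K x^b - c h x^β` is largest where `x^{β - b}` is of order `1 / h`, which gives
the power `h^{-b / (β - b)}`. -/
theorem exponent_le {c K b β h x : ℝ} (hc : 0 < c) (hK : 0 ≤ K) (hb : 1 ≤ b) (hbβ : b < β)
    (hh : 0 < h) (hx : 1 ≤ x) :
    2 * K * x ^ b - c * x ^ β * h ≤
      (2 * K + 1) * ((2 * K + 1) / c) ^ (b / (β - b)) * h ^ (-(b / (β - b))) - x := by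
  have hxp : 0 < x := by linarith
  have hxb : x ≤ x ^ b := by simpa using Real.rpow_le_rpow_of_exponent_le hx hb
  set y := (2 * K + 1) / (c * h) with hy
  have hy0 : 0 < y := by positivity
  have hright : (2 * K + 1) * ((2 * K + 1) / c) ^ (b / (β - b)) * h ^ (-(b / (β - b))) =
      (2 * K + 1) * y ^ (b / (β - b)) := by
    rw [hy, ← div_div, Real.div_rpow (by positivity) hh.le, Real.rpow_neg hh.le]
    ring
  rw [hright]
  have hsplit : x ^ β = x ^ b * x ^ (β - b) := by
    rw [← Real.rpow_add hxp]; congr 1; ring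
  rcases le_total y (x ^ (β - b)) with hle | hle
  · have h1 : 2 * K + 1 ≤ c * h * x ^ (β - b) := by
      rw [hy, div_le_iff₀ (by positivity)] at hle
      linarith
    have h2 : 0 ≤ (2 * K + 1) * y ^ (b / (β - b)) := by positivity
    have h3 := mul_le_mul_of_nonneg_left h1 (by positivity : 0 ≤ x ^ b)
    rw [hsplit]
    nlinarith
  · have h1 : x ^ b ≤ y ^ (b / (β - b)) := by
      have h2 := Real.rpow_le_rpow (by positivity) hle
        (div_nonneg (by linarith) (by linarith) : 0 ≤ b / (β - b))
      rw [← Real.rpow_mul hxp.le, mul_div_cancel₀ _ (by linarith : β - b ≠ 0)] at h2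
      exact h2
    have h3 := mul_le_mul_of_nonneg_left h1 (by linarith : 0 ≤ 2 * K + 1)
    have h4 : 0 ≤ c * x ^ β * h := by positivity
    linarith

theorem exists_tsum_weight_le {μ : ℕ → ℝ} (hpos : ∀ n, 0 < μ n) {c β : ℝ} (hc : 0 < c)
    (hcμ : ∀ n : ℕ, c * ((n : ℝ) + 1) ^ β ≤ μ n) {b K : ℝ} (hb : 1 ≤ b) (hbβ : b < β)
    (hK : 0 ≤ K) :
    ∃ A : ℝ, 0 ≤ A ∧ ∀ h : ℝ, 0 < h →
      Summable (fun n : ℕ => 2 * μ n * Real.exp (2 * K * ((n : ℝ) + 1) ^ b - 2 * μ n * h)) ∧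
      ∑' n : ℕ, 2 * μ n * Real.exp (2 * K * ((n : ℝ) + 1) ^ b - 2 * μ n * h) ≤
        4 / h * Real.exp (A * h ^ (-(b / (β - b)))) := by
  refine ⟨(2 * K + 1) * ((2 * K + 1) / c) ^ (b / (β - b)), by positivity, fun h hh => ?_⟩
  set E := (2 * K + 1) * ((2 * K + 1) / c) ^ (b / (β - b)) * h ^ (-(b / (β - b)))
  have hterm : ∀ n : ℕ, 2 * μ n * Real.exp (2 * K * ((n : ℝ) + 1) ^ b - 2 * μ n * h) ≤
      2 / h * Real.exp E * (1 / 2) ^ n := by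
    intro n
    have h1 : μ n * h ≤ Real.exp (μ n * h) := by linarith [Real.add_one_le_exp (μ n * h)]
    have h2 : 2 * μ n ≤ 2 / h * Real.exp (μ n * h) := by
      rw [div_mul_eq_mul_div, le_div_iff₀ hh]; linarith
    have h3 : 2 * K * ((n : ℝ) + 1) ^ b - μ n * h ≤ E - ((n : ℝ) + 1) :=
      le_trans (by nlinarith [hcμ n]) (exponent_le hc hK hb hbβ hh (by simp))
    have h4 : Real.exp (-1) ≤ 1 / 2 := by
      rw [Real.exp_neg, one_div]
      exact inv_anti₀ two_pos (by linarith [Real.exp_one_gt_d9])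
    have h5 : Real.exp (-(n : ℝ)) ≤ (1 / 2) ^ n := by
      rw [show -(n : ℝ) = n * (-1) by ring, Real.exp_nat_mul]
      exact pow_le_pow_left₀ (Real.exp_pos _).le h4 n
    calc 2 * μ n * Real.exp (2 * K * ((n : ℝ) + 1) ^ b - 2 * μ n * h)
        ≤ 2 / h * Real.exp (μ n * h) * Real.exp (2 * K * ((n : ℝ) + 1) ^ b - 2 * μ n * h) := by
          gcongr
      _ = 2 / h * Real.exp (2 * K * ((n : ℝ) + 1) ^ b - μ n * h) := by
          rw [mul_assoc, ← Real.exp_add]; congr 2; ring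
      _ ≤ 2 / h * Real.exp (E + -(n : ℝ)) := by gcongr; linarith
      _ = 2 / h * Real.exp E * Real.exp (-(n : ℝ)) := by rw [Real.exp_add, mul_assoc]
      _ ≤ _ := by gcongr
  have hgeo : Summable fun n : ℕ => 2 / h * Real.exp E * (1 / 2 : ℝ) ^ n :=
    summable_geometric_two.mul_left _
  have hs : Summable
      (fun n : ℕ => 2 * μ n * Real.exp (2 * K * ((n : ℝ) + 1) ^ b - 2 * μ n * h)) :=
    Summable.of_nonneg_of_le
      (fun n => mul_nonneg (by linarith [hpos n]) (Real.exp_pos _).le) hterm hgeo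
  refine ⟨hs, (hs.tsum_le_tsum hterm hgeo).trans (le_of_eq ?_)⟩
  rw [tsum_mul_left, tsum_geometric_two]
  ring

theorem summable_expWeight_mul_exp {μ : ℕ → ℝ} (hpos : ∀ n, 0 < μ n) (hmono : StrictMono μ)
    {c β : ℝ} (hc : 0 < c) (hcμ : ∀ n : ℕ, c * ((n : ℝ) + 1) ^ β ≤ μ n) {b K : ℝ} (hb : 1 ≤ b)
    (hbβ : b < β) (hK : 0 ≤ K) {t : ℝ} (ht : 0 < t) :
    Summable fun n => expWeight μ K b n * Real.exp (-(μ n) * t) := by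
  obtain ⟨A, -, hA⟩ := exists_tsum_weight_le hpos hc hcμ hb hbβ hK
  refine Summable.of_nonneg_of_le
    (fun n => mul_nonneg (expWeight_pos hpos K b n).le (Real.exp_pos _).le) (fun n => ?_)
    ((hA (t / 2) (half_pos ht)).1.mul_left (Real.sqrt (2 * μ 0))⁻¹)
  have h0 : 0 < Real.sqrt (2 * μ 0) := Real.sqrt_pos.2 (by linarith [hpos 0])
  have h1 : Real.sqrt (2 * μ 0) ≤ expWeight μ K b n := by
    have h2 : Real.sqrt (2 * μ 0) ≤ Real.sqrt (2 * μ n) :=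
      Real.sqrt_le_sqrt (by linarith [hmono.monotone (Nat.zero_le n)])
    exact h2.trans (le_mul_of_one_le_right (Real.sqrt_nonneg _) (Real.one_le_exp (by positivity)))
  have h2 : 2 * μ n * Real.exp (2 * K * ((n : ℝ) + 1) ^ b - 2 * μ n * (t / 2)) =
      expWeight μ K b n ^ 2 * Real.exp (-(μ n) * t) := by
    rw [expWeight, mul_pow, Real.sq_sqrt (by linarith [hpos n]), ← Real.exp_nat_mul,
      mul_assoc (2 * μ n) (Real.exp _), ← Real.exp_add]
    congr 2
    push_cast
    ring
  rw [h2, ← mul_assoc]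
  refine mul_le_mul_of_nonneg_right ?_ (Real.exp_pos _).le
  rw [inv_mul_eq_div, le_div_iff₀ h0, sq]
  exact mul_le_mul_of_nonneg_left h1 (expWeight_pos hpos K b n).le

/-! ### Comparison of the norms on a finite interval and on the half line -/

theorem expSum_eq_tsum (μ : ℕ → ℝ) (a : ℕ →₀ ℝ) (t : ℝ) :
    expSum μ a t = ∑' k, a k * Real.exp (-(μ k) * t) := by
  rw [expSum, Finsupp.sum, tsum_eq_sum]
  intro k hk
  rw [Finsupp.notMem_support_iff.1 hk, zero_mul]

theorem expSum_smul (μ : ℕ → ℝ) (r : ℝ) (a : ℕ →₀ ℝ) (t : ℝ) :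
    expSum μ (r • a) t = r * expSum μ a t := by
  rw [expSum, Finsupp.sum_smul_index (by simp), expSum, Finsupp.mul_sum]
  simp only [mul_assoc]

section DirichletSeries

variable {μ D : ℕ → ℝ}

theorem continuousOn_dirichletSeries (hpos : ∀ n, 0 < μ n)
    {a : ℕ → ℝ} (ha : ∀ n, |a n| ≤ D n) {t₀ : ℝ}
    (hsum : Summable fun n => D n * Real.exp (-(μ n) * t₀)) :
    ContinuousOn (fun t => ∑' n, a n * Real.exp (-(μ n) * t)) (Ici t₀) := by
  refine continuousOn_tsum (fun n => by fun_prop) hsum fun n t ht => ?_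
  rw [norm_mul, Real.norm_eq_abs, Real.norm_of_nonneg (Real.exp_pos _).le]
  refine mul_le_mul (ha n) (Real.exp_le_exp.2 ?_) (Real.exp_pos _).le ((abs_nonneg _).trans (ha n))
  nlinarith [hpos n, mem_Ici.1 ht]

/-- A real Dirichlet series that vanishes on an interval vanishes to its right: it extends to an
analytic function on a half plane. -/
theorem dirichletSeries_eq_zero (hpos : ∀ n, 0 < μ n)
    {a : ℕ → ℝ} (ha : ∀ n, |a n| ≤ D n) {t₀ t₁ : ℝ} (h01 : t₀ < t₁)
    (hsum : Summable fun n => D n * Real.exp (-(μ n) * t₀))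
    (hzero : ∀ t ∈ Ioo t₀ t₁, ∑' n, a n * Real.exp (-(μ n) * t) = 0) {t : ℝ} (ht : t₀ < t) :
    ∑' n, a n * Real.exp (-(μ n) * t) = 0 := by
  set U : Set ℂ := {z | t₀ < z.re} with hU
  have hUo : IsOpen U := isOpen_lt continuous_const Complex.continuous_re
  set F : ℂ → ℂ := fun z => ∑' n, (a n : ℂ) * Complex.exp (-(μ n) * z) with hF
  have hFreal : ∀ x : ℝ, F x = ((∑' n, a n * Real.exp (-(μ n) * x) : ℝ) : ℂ) := by
    intro x
    rw [Complex.ofReal_tsum]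
    push_cast
    rfl
  have hdiff : DifferentiableOn ℂ F U := by
    refine Complex.differentiableOn_tsum_of_summable_norm hsum
      (fun n => by fun_prop) hUo fun n z hz => ?_
    rw [norm_mul, Complex.norm_exp, Complex.norm_real, Real.norm_eq_abs]
    refine mul_le_mul (ha n) (Real.exp_le_exp.2 ?_) (Real.exp_pos _).le
      ((abs_nonneg _).trans (ha n))
    have : (-(μ n : ℂ) * z).re = -(μ n) * z.re := by simp
    rw [this]
    have hz' : t₀ < z.re := hz
    nlinarith [hpos n]
  have han : AnalyticOnNhd ℂ F U := hdiff.analyticOnNhd hUo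
  have hconn : IsPreconnected U := (convex_halfSpace_re_gt t₀).isPreconnected
  set x₀ : ℝ := (t₀ + t₁) / 2 with hx₀
  have hx₀m : x₀ ∈ Ioo t₀ t₁ := ⟨by rw [hx₀]; linarith, by rw [hx₀]; linarith⟩
  have hfreq : ∃ᶠ z in 𝓝[≠] (x₀ : ℂ), F z = 0 := by
    have htend : Tendsto (fun x : ℝ => (x : ℂ)) (𝓝[≠] x₀) (𝓝[≠] (x₀ : ℂ)) :=
      Complex.continuous_ofReal.continuousAt.continuousWithinAt.tendsto_nhdsWithin
        fun x hx => by simpa using hx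
    refine htend.frequently (Eventually.frequently ?_)
    filter_upwards [mem_nhdsWithin_of_mem_nhds (isOpen_Ioo.mem_nhds hx₀m)] with x hx
    rw [hFreal, hzero x hx, Complex.ofReal_zero]
  have h0 := han.eqOn_zero_of_preconnected_of_frequently_eq_zero hconn
    (show (x₀ : ℂ) ∈ U by simpa [hU] using hx₀m.1) hfreq
    (show (t : ℂ) ∈ U by simpa [hU] using ht)
  rw [hFreal, Pi.zero_apply] at h0
  exact_mod_cast h0

/-- Exponential sums with dominated, convergent coefficients converge in `L²` away from `0`. -/
theorem tendsto_integral_expSum_sq (hpos : ∀ n, 0 < μ n) (hmono : StrictMono μ) {t₀ : ℝ}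
    (hsum : Summable fun n => D n * Real.exp (-(μ n) * t₀)) {A : ℕ → ℕ →₀ ℝ}
    (hA : ∀ j n, |A j n| ≤ D n) {a : ℕ → ℝ} (ha : ∀ n, Tendsto (fun j => A j n) atTop (𝓝 (a n)))
    {I : Set ℝ} (hI : MeasurableSet I) (hI₀ : I ⊆ Ici t₀) :
    Tendsto (fun j => ∫ t in I, expSum μ (A j) t ^ 2) atTop
      (𝓝 (∫ t in I, (∑' n, a n * Real.exp (-(μ n) * t)) ^ 2)) := by
  set G := ∑' n, D n * Real.exp (-(μ n) * t₀)
  have hD : ∀ n, 0 ≤ D n := fun n => (abs_nonneg _).trans (hA 0 n)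
  have hexp : ∀ n t, t₀ ≤ t → Real.exp (-(μ n) * t) ≤
      Real.exp (-(μ n) * t₀) * Real.exp (-(μ 0) * (t - t₀)) := by
    intro n t ht
    rw [← Real.exp_add]
    apply Real.exp_le_exp.2
    nlinarith [hmono.monotone (Nat.zero_le n)]
  have hterm : ∀ j n t, t₀ ≤ t → |A j n * Real.exp (-(μ n) * t)| ≤
      D n * Real.exp (-(μ n) * t₀) * Real.exp (-(μ 0) * (t - t₀)) := by
    intro j n t ht
    rw [abs_mul, Real.abs_exp, mul_assoc]
    exact mul_le_mul (hA j n) (hexp n t ht) (Real.exp_pos _).le (hD n)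
  refine tendsto_integral_of_dominated_convergence
    (fun t => (G * Real.exp (-(μ 0) * (t - t₀))) ^ 2)
    (fun j => ((continuous_expSum μ (A j)).pow 2).aestronglyMeasurable) ?_ ?_ ?_
  · have h1 : IntegrableOn (fun t => G ^ 2 * Real.exp (2 * μ 0 * t₀) *
        Real.exp (-(2 * μ 0) * t)) (Ici t₀) := by
      rw [integrableOn_Ici_iff_integrableOn_Ioi]
      exact (integrableOn_exp_mul_Ioi (by linarith [hpos 0]) t₀).const_mul _
    refine (h1.mono_set hI₀).congr (Eventually.of_forall fun t => ?_)
    simp only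
    rw [mul_pow, ← Real.exp_nat_mul, mul_assoc, ← Real.exp_add]
    congr 2
    push_cast
    ring
  · intro j
    filter_upwards [ae_restrict_mem hI] with t ht
    have ht' : t₀ ≤ t := hI₀ ht
    rw [norm_pow, Real.norm_eq_abs]
    refine pow_le_pow_left₀ (abs_nonneg _) ?_ 2
    rw [expSum_eq_tsum, ← Real.norm_eq_abs]
    exact tsum_of_norm_bounded (hsum.hasSum.mul_right _) fun n => hterm j n t ht'
  · filter_upwards [ae_restrict_mem hI] with t ht
    have ht' : t₀ ≤ t := hI₀ ht
    simp only [expSum_eq_tsum]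
    exact (tendsto_tsum_of_dominated_convergence (hsum.mul_right _)
      (fun n => (ha n).mul_const _) (Eventually.of_forall fun j n => hterm j n t ht')).pow 2

/-- On exponential sums, the norm of `L²(0, T)` is equivalent to the norm of `L²(0, ∞)`. Otherwise
there are normalized sums that tend to zero in `L²(0, T)`; by compactness their coefficients
converge along a subsequence, to those of a Dirichlet series that vanishes on `(T / 2, T)` and
hence on `(T, ∞)`, so that the norms on `(0, ∞)` tend to zero, too. -/
theorem exists_integral_Ici_le_mul_integral_Icc (hpos : ∀ n, 0 < μ n) (hmono : StrictMono μ)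
    (hcoeff : ∀ (a : ℕ →₀ ℝ) (n : ℕ),
      |a n| ≤ D n * Real.sqrt (∫ t in Ici (0 : ℝ), expSum μ a t ^ 2))
    (hsum : ∀ t : ℝ, 0 < t → Summable fun n => D n * Real.exp (-(μ n) * t)) {T : ℝ} (hT : 0 < T) :
    ∃ κ : ℝ, 0 < κ ∧ ∀ a : ℕ →₀ ℝ,
      ∫ t in Ici (0 : ℝ), expSum μ a t ^ 2 ≤ κ * ∫ t in Icc 0 T, expSum μ a t ^ 2 := by
  by_contra! hcon
  have hbad : ∀ j : ℕ, ∃ a : ℕ →₀ ℝ, ∫ t in Ici (0 : ℝ), expSum μ a t ^ 2 = 1 ∧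
      ((j : ℝ) + 1) * ∫ t in Icc 0 T, expSum μ a t ^ 2 ≤ 1 := by
    intro j
    obtain ⟨a, ha⟩ := hcon (j + 1) (by positivity)
    set N := ∫ t in Ici (0 : ℝ), expSum μ a t ^ 2
    have hI0 : 0 ≤ ∫ t in Icc 0 T, expSum μ a t ^ 2 := integral_nonneg fun t => sq_nonneg _
    have hN : 0 < N := lt_of_le_of_lt (by positivity) ha
    have hsc : ∀ t, expSum μ ((Real.sqrt N)⁻¹ • a) t ^ 2 = N⁻¹ * expSum μ a t ^ 2 := by
      intro t
      rw [expSum_smul, mul_pow, inv_pow, Real.sq_sqrt hN.le]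
    refine ⟨(Real.sqrt N)⁻¹ • a, ?_, ?_⟩
    · simp only [hsc]
      rw [integral_const_mul]
      exact inv_mul_cancel₀ hN.ne'
    · simp only [hsc]
      rw [integral_const_mul, mul_left_comm, inv_mul_eq_div, div_le_one hN]
      exact ha.le
  choose A hA1 hA2 using hbad
  have hAD : ∀ j n, |A j n| ≤ D n := fun j n => by simpa [hA1 j] using hcoeff (A j) n
  have hcompact : IsCompact (Set.pi univ fun n => Icc (-D n) (D n)) :=
    isCompact_univ_pi fun n => isCompact_Icc
  obtain ⟨a, -, ψ, hψ, hlim⟩ := hcompact.tendsto_subseq (x := fun j n => A j n)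
    fun j n _ => abs_le.1 (hAD j n)
  have hlim' : ∀ n, Tendsto (fun j => A (ψ j) n) atTop (𝓝 (a n)) := tendsto_pi_nhds.1 hlim
  have haD : ∀ n, |a n| ≤ D n := fun n =>
    le_of_tendsto (hlim' n).abs (Eventually.of_forall fun j => hAD (ψ j) n)
  have hT2 : 0 < T / 2 := half_pos hT
  have hconv := fun {I : Set ℝ} (hI : MeasurableSet I) (hI₀ : I ⊆ Ici (T / 2)) =>
    tendsto_integral_expSum_sq hpos hmono (hsum _ hT2) (fun j n => hAD (ψ j) n) hlim' hI hI₀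
  have hsmall : Tendsto (fun j => ∫ t in Icc 0 T, expSum μ (A (ψ j)) t ^ 2) atTop (𝓝 0) := by
    have h1 : Tendsto (fun j : ℕ => 1 / ((j : ℝ) + 1)) atTop (𝓝 0) :=
      tendsto_one_div_add_atTop_nhds_zero_nat
    refine squeeze_zero (fun j => integral_nonneg fun t => sq_nonneg _) (fun j => ?_)
      (h1.comp hψ.tendsto_atTop)
    have := hA2 (ψ j)
    simp only [Function.comp]
    rw [le_div_iff₀ (by positivity)]
    linarith
  set F : ℝ → ℝ := fun t => ∑' n, a n * Real.exp (-(μ n) * t) with hF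
  have hFcont : ContinuousOn F (Ici (T / 2)) := continuousOn_dirichletSeries hpos haD (hsum _ hT2)
  have hsub : Ioo (T / 2) T ⊆ Icc 0 T := fun t ht => ⟨by linarith [ht.1], ht.2.le⟩
  have hFint : ∫ t in Ioo (T / 2) T, F t ^ 2 = 0 := by
    refine tendsto_nhds_unique (hconv measurableSet_Ioo fun t ht => ht.1.le)
      (squeeze_zero (fun j => integral_nonneg fun t => sq_nonneg _) (fun j => ?_) hsmall)
    exact setIntegral_mono_set
      (((continuous_expSum μ _).pow 2).continuousOn.integrableOn_compact isCompact_Icc)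
      (Eventually.of_forall fun t => sq_nonneg _) hsub.eventuallyLE
  have hFzero : ∀ t ∈ Ioo (T / 2) T, F t = 0 := by
    have hc : ContinuousOn (fun t => F t ^ 2) (Ioo (T / 2) T) :=
      (hFcont.mono fun t ht => mem_Ici.2 ht.1.le).pow 2
    have hi : IntegrableOn (fun t => F t ^ 2) (Ioo (T / 2) T) :=
      (((hFcont.mono fun t ht => mem_Ici.2 ht.1).pow 2).integrableOn_compact
        (isCompact_Icc (a := T / 2) (b := T))).mono_set Ioo_subset_Icc_self
    have hae := (setIntegral_eq_zero_iff_of_nonneg_ae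
      (Eventually.of_forall fun t => sq_nonneg (F t)) hi).1 hFint
    have heq := Measure.eqOn_open_of_ae_eq hae isOpen_Ioo hc continuousOn_const
    exact fun t ht => pow_eq_zero_iff two_ne_zero |>.1 (heq ht)
  have hFtail : ∫ t in Ioi T, F t ^ 2 = 0 := by
    refine setIntegral_eq_zero_of_forall_eq_zero fun t ht => ?_
    have := dirichletSeries_eq_zero hpos haD (half_lt_self hT) (hsum _ hT2) hFzero
      ((half_lt_self hT).trans ht)
    rw [hF]
    simp only [this]
    norm_num
  have htail := hconv (I := Ioi T) measurableSet_Ioi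
    fun t ht => mem_Ici.2 ((half_lt_self hT).trans ht).le
  rw [hFtail] at htail
  have hone := hsmall.add htail
  have hsplit : ∀ j, (∫ t in Icc 0 T, expSum μ (A (ψ j)) t ^ 2) +
      ∫ t in Ioi T, expSum μ (A (ψ j)) t ^ 2 = 1 := by
    intro j
    have hint := integrableOn_expSum_sq hpos (A (ψ j))
    have hdisj : Disjoint (Icc 0 T) (Ioi T) :=
      Set.disjoint_left.2 fun t ht h => not_lt.2 ht.2 h
    rw [← setIntegral_union hdisj measurableSet_Ioi
      (hint.mono_set Icc_subset_Ici_self)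
      (hint.mono_set fun t ht => mem_Ici.2 (hT.trans ht).le), Icc_union_Ioi_eq_Ici hT.le, hA1]
  simp only [hsplit, add_zero] at hone
  exact one_ne_zero (tendsto_nhds_unique tendsto_const_nhds hone)

end DirichletSeries

theorem exists_isDistComparison {μ D : ℕ → ℝ} (hpos : ∀ n, 0 < μ n) (hmono : StrictMono μ)
    (hcoeff : ∀ (a : ℕ →₀ ℝ) (n : ℕ),
      |a n| ≤ D n * Real.sqrt (∫ t in Ici (0 : ℝ), expSum μ a t ^ 2))
    (hsum : ∀ t : ℝ, 0 < t → Summable fun n => D n * Real.exp (-(μ n) * t)) {T : ℝ} (hT : 0 < T) :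
    ∃ κ : ℝ, IsDistComparison μ T κ := by
  obtain ⟨κ, hκ, h⟩ := exists_integral_Ici_le_mul_integral_Icc hpos hmono hcoeff hsum hT
  have hκ' := Real.sqrt_pos.2 hκ
  refine ⟨Real.sqrt κ, hκ', fun n => le_expDist fun a ha => ?_⟩
  rw [inv_mul_le_iff₀ hκ', ← Real.sqrt_mul hκ.le]
  refine le_trans ?_ (Real.sqrt_le_sqrt (h a))
  have h1 := expDist_le μ (Ici 0) n (a := Finsupp.single n 1 - a) (by simp [ha])
  simpa only [exp_sub_sum_eq_expSum, sub_sub_cancel] using h1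

/-! ### Biorthogonal functions on a finite interval -/

/-- A vector at distance at least `d` from the span of the others has a dual vector of norm at most
`d⁻¹`, a multiple of the residual of the orthogonal projection to the closed span. -/
theorem exists_biorthogonal_vector {𝕜 E ι : Type*} [RCLike 𝕜] [NormedAddCommGroup E]
    [InnerProductSpace 𝕜 E] [CompleteSpace E] (e : ι → E) (n : ι) {d : ℝ} (hd : 0 < d)
    (h : ∀ g ∈ Submodule.span 𝕜 (e '' {k | k ≠ n}), d ≤ ‖e n - g‖) :
    ∃ q : E, ‖q‖ ≤ d⁻¹ ∧ inner 𝕜 (e n) q = 1 ∧ ∀ k, k ≠ n → inner 𝕜 (e k) q = 0 := by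
  set V := (Submodule.span 𝕜 (e '' {k | k ≠ n})).topologicalClosure with hV
  have : CompleteSpace V := (Submodule.isClosed_topologicalClosure _).completeSpace_coe
  set r := e n - V.starProjection (e n) with hr
  have hrV : ∀ v ∈ V, inner 𝕜 v r = 0 :=
    (Submodule.mem_orthogonal V r).1 (V.sub_starProjection_mem_orthogonal (e n))
  have hdr : d ≤ ‖r‖ := by
    have hcl : IsClosed {g : E | d ≤ ‖e n - g‖} :=
      isClosed_le continuous_const (by fun_prop)
    exact closure_minimal h hcl (V.starProjection_apply_mem (e n))
  have hr0 : 0 < ‖r‖ := hd.trans_le hdr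
  have hinner : inner 𝕜 (e n) r = ((‖r‖ ^ 2 : ℝ) : 𝕜) := by
    have h1 : e n = r + V.starProjection (e n) := by rw [hr, sub_add_cancel]
    conv_lhs => rw [h1]
    rw [inner_add_left, hrV _ (V.starProjection_apply_mem _), add_zero, inner_self_eq_norm_sq_to_K]
    push_cast
    rfl
  refine ⟨(((‖r‖ ^ 2)⁻¹ : ℝ) : 𝕜) • r, ?_, ?_, fun k hk => ?_⟩
  · rw [norm_smul, RCLike.norm_ofReal, abs_of_pos (by positivity)]
    calc (‖r‖ ^ 2)⁻¹ * ‖r‖ = ‖r‖⁻¹ := by field_simp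
      _ ≤ d⁻¹ := inv_anti₀ hd hdr
  · rw [inner_smul_right, hinner, ← RCLike.ofReal_mul, inv_mul_cancel₀ (by positivity),
      RCLike.ofReal_one]
  · rw [inner_smul_right, hrV (e k)
      (Submodule.le_topologicalClosure _ (Submodule.subset_span ⟨k, hk, rfl⟩)), mul_zero]

/-- The distance on an interval is the one on a translate, up to the factor `e^{-μₙ t₀}` that
normalizes the `n`-th exponential. -/
theorem exp_mul_expDist_le (μ : ℕ → ℝ) {t₀ t₁ : ℝ} (h01 : t₀ ≤ t₁) {a : ℕ →₀ ℝ} {n : ℕ}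
    (ha : a n = 1) :
    Real.exp (-(μ n) * t₀) * expDist μ (Icc 0 (t₁ - t₀)) n ≤
      Real.sqrt (∫ t in Icc t₀ t₁, expSum μ a t ^ 2) := by
  set b : ℕ →₀ ℝ := Finsupp.onFinset a.support
    (fun k => a k * (Real.exp (-(μ k) * t₀) * Real.exp (μ n * t₀)))
    (fun k hk => Finsupp.mem_support_iff.2 fun h => hk (by rw [h, zero_mul])) with hb
  have hbk : ∀ k, b k = a k * (Real.exp (-(μ k) * t₀) * Real.exp (μ n * t₀)) := fun k => rfl
  have hbn : b n = 1 := by rw [hbk, ha, ← Real.exp_add]; simp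
  have hab : ∀ t, expSum μ a (t + t₀) = Real.exp (-(μ n) * t₀) * expSum μ b t := by
    intro t
    rw [expSum_eq_tsum, expSum_eq_tsum, ← tsum_mul_left]
    refine tsum_congr fun k => ?_
    have h1 : Real.exp (-(μ n) * t₀) * Real.exp (μ n * t₀) = 1 := by rw [← Real.exp_add]; simp
    rw [hbk, mul_add, Real.exp_add]
    linear_combination (-(a k * Real.exp (-(μ k) * t) * Real.exp (-(μ k) * t₀))) * h1
  have hint : ∫ t in Icc t₀ t₁, expSum μ a t ^ 2 =
      Real.exp (-(μ n) * t₀) ^ 2 * ∫ t in Icc 0 (t₁ - t₀), expSum μ b t ^ 2 := by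
    rw [integral_Icc_eq_integral_Ioc, ← intervalIntegral.integral_of_le h01,
      integral_Icc_eq_integral_Ioc, ← intervalIntegral.integral_of_le (sub_nonneg.2 h01),
      ← intervalIntegral.integral_const_mul]
    simp only [← mul_pow, ← hab]
    rw [intervalIntegral.integral_comp_add_right (fun t => expSum μ a t ^ 2) t₀, zero_add,
      sub_add_cancel]
  rw [hint, Real.sqrt_mul (sq_nonneg _), Real.sqrt_sq (Real.exp_pos _).le]
  refine mul_le_mul_of_nonneg_left ?_ (Real.exp_pos _).le
  have h1 := expDist_le μ (Icc 0 (t₁ - t₀)) n (a := Finsupp.single n 1 - b) (by simp [hbn])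
  simpa only [exp_sub_sum_eq_expSum, sub_sub_cancel] using h1

section ExpLp

variable (𝕜 : Type*) [RCLike 𝕜]

theorem memLp_ofReal_exp (l t₀ t₁ : ℝ) :
    MemLp (fun t : ℝ => ((Real.exp (-l * t) : ℝ) : 𝕜)) 2 (volume.restrict (Icc t₀ t₁)) := by
  have hc : Continuous fun t : ℝ => ((Real.exp (-l * t) : ℝ) : 𝕜) :=
    RCLike.continuous_ofReal.comp (by fun_prop)
  obtain ⟨B, hB⟩ := isCompact_Icc.exists_bound_of_continuousOn (s := Icc t₀ t₁) hc.continuousOn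
  refine MemLp.of_bound hc.aestronglyMeasurable B ?_
  filter_upwards [ae_restrict_mem measurableSet_Icc] with t ht using hB t ht

/-- The exponential `e^{-l t}` as an element of `L²(t₀, t₁)` over `𝕜`. -/
noncomputable def expLp (t₀ t₁ l : ℝ) : Lp 𝕜 2 (volume.restrict (Icc t₀ t₁)) :=
  (memLp_ofReal_exp 𝕜 l t₀ t₁).toLp _

variable {𝕜}

theorem coeFn_linearCombination_expLp (μ : ℕ → ℝ) (t₀ t₁ : ℝ) (l : ℕ →₀ 𝕜) :
    (Finsupp.linearCombination 𝕜 (fun n => expLp 𝕜 t₀ t₁ (μ n)) l : ℝ → 𝕜)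
      =ᵐ[volume.restrict (Icc t₀ t₁)]
      fun t => l.sum fun k x => x * ((Real.exp (-(μ k) * t) : ℝ) : 𝕜) := by
  induction l using Finsupp.induction_linear with
  | zero =>
    rw [map_zero]
    filter_upwards [Lp.coeFn_zero 𝕜 2 (volume.restrict (Icc t₀ t₁))] with t ht
    rw [ht, Finsupp.sum_zero_index]
    rfl
  | add f g hf hg =>
    rw [map_add]
    filter_upwards [hf, hg, Lp.coeFn_add
      (Finsupp.linearCombination 𝕜 (fun n => expLp 𝕜 t₀ t₁ (μ n)) f)
      (Finsupp.linearCombination 𝕜 (fun n => expLp 𝕜 t₀ t₁ (μ n)) g)] with t h1 h2 h3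
    rw [h3, Pi.add_apply, h1, h2,
      Finsupp.sum_add_index' (by simp) (by intros; ring)]
  | single k x =>
    rw [Finsupp.linearCombination_single]
    filter_upwards [Lp.coeFn_smul x (expLp 𝕜 t₀ t₁ (μ k)),
      (memLp_ofReal_exp 𝕜 (μ k) t₀ t₁).coeFn_toLp] with t h1 h2
    rw [h1, Pi.smul_apply, expLp, h2, Finsupp.sum_single_index (by simp), smul_eq_mul]

theorem norm_sq_eq_integral_norm_sq {X : Type*} [MeasurableSpace X] {ρ : Measure X}
    (f : Lp 𝕜 2 ρ) : ‖f‖ ^ 2 = ∫ x, ‖f x‖ ^ 2 ∂ρ := by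
  have h1 : ((‖f‖ ^ 2 : ℝ) : 𝕜) = ((∫ x, ‖f x‖ ^ 2 ∂ρ : ℝ) : 𝕜) := by
    rw [← integral_ofReal]
    push_cast
    rw [← inner_self_eq_norm_sq_to_K (𝕜 := 𝕜), L2.inner_def]
    simp only [inner_self_eq_norm_sq_to_K]
  exact_mod_cast h1

/-- Passing to complex coefficients does not decrease the distance: real parts contract. -/
theorem exp_mul_expDist_le_norm (μ : ℕ → ℝ) {t₀ t₁ : ℝ} (h01 : t₀ ≤ t₁) (n : ℕ)
    {g : Lp 𝕜 2 (volume.restrict (Icc t₀ t₁))}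
    (hg : g ∈ Submodule.span 𝕜 ((fun n => expLp 𝕜 t₀ t₁ (μ n)) '' {k | k ≠ n})) :
    Real.exp (-(μ n) * t₀) * expDist μ (Icc 0 (t₁ - t₀)) n ≤ ‖expLp 𝕜 t₀ t₁ (μ n) - g‖ := by
  obtain ⟨l, hl, rfl⟩ := (Finsupp.mem_span_image_iff_linearCombination 𝕜).1 hg
  have hln : l n = 0 := by
    by_contra hne
    exact ((Finsupp.mem_supported 𝕜 l).1 hl (Finsupp.mem_support_iff.2 hne)) rfl
  have hdiff : expLp 𝕜 t₀ t₁ (μ n) - Finsupp.linearCombination 𝕜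
      (fun n => expLp 𝕜 t₀ t₁ (μ n)) l = Finsupp.linearCombination 𝕜
      (fun n => expLp 𝕜 t₀ t₁ (μ n)) (Finsupp.single n 1 - l) := by
    rw [map_sub, Finsupp.linearCombination_single, one_smul]
  rw [hdiff]
  set l' := Finsupp.single n (1 : 𝕜) - l with hl'
  set a : ℕ →₀ ℝ := l'.mapRange RCLike.re (map_zero _) with ha
  have han : a n = 1 := by simp [ha, hl', hln]
  refine (exp_mul_expDist_le μ h01 han).trans ?_
  apply Real.sqrt_le_iff.2 ⟨norm_nonneg _, ?_⟩
  rw [norm_sq_eq_integral_norm_sq]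
  refine integral_mono_ae
    (((continuous_expSum μ a).pow 2).continuousOn.integrableOn_compact isCompact_Icc)
    (Lp.memLp _).integrable_norm_pow' ?_
  filter_upwards [coeFn_linearCombination_expLp μ t₀ t₁ l'] with t ht
  rw [ht]
  have hre : expSum μ a t =
      RCLike.re (l'.sum fun k x => x * ((Real.exp (-(μ k) * t) : ℝ) : 𝕜)) := by
    rw [expSum, ha, Finsupp.sum_mapRange_index (by simp), map_finsuppSum]
    simp
  rw [hre]
  exact sq_le_sq.2 (by rw [abs_norm]; exact RCLike.abs_re_le_norm _)

theorem exists_biorthogonal (μ : ℕ → ℝ) {t₀ t₁ : ℝ} (h01 : t₀ ≤ t₁)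
    (hd : ∀ n, 0 < expDist μ (Icc 0 (t₁ - t₀)) n) :
    ∃ q : ℕ → Lp 𝕜 2 (volume.restrict (Icc t₀ t₁)),
      (∀ n, ‖q n‖ ≤ Real.exp (μ n * t₀) * (expDist μ (Icc 0 (t₁ - t₀)) n)⁻¹) ∧
      ∀ k n, inner 𝕜 (expLp 𝕜 t₀ t₁ (μ k)) (q n) = if k = n then 1 else 0 := by
  have h := fun n => exists_biorthogonal_vector (𝕜 := 𝕜) (fun n => expLp 𝕜 t₀ t₁ (μ n)) n
    (mul_pos (Real.exp_pos (-(μ n) * t₀)) (hd n))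
    (fun g hg => exp_mul_expDist_le_norm μ h01 n hg)
  choose q hq1 hq2 hq3 using h
  refine ⟨q, fun n => (hq1 n).trans (le_of_eq ?_), fun k n => ?_⟩
  · rw [mul_inv, ← Real.exp_neg, neg_mul, neg_neg]
  · split_ifs with hkn
    · rw [hkn]; exact hq2 n
    · exact hq3 n k hkn

/-- `expLp` is real, so that pairing with it in `L²` is integration against the exponential. -/
theorem inner_expLp (t₀ t₁ l : ℝ) (f : Lp 𝕜 2 (volume.restrict (Icc t₀ t₁))) :
    inner 𝕜 (expLp 𝕜 t₀ t₁ l) f = ∫ t in Icc t₀ t₁, f t * ((Real.exp (-l * t) : ℝ) : 𝕜) := by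
  rw [L2.inner_def]
  refine integral_congr_ae ?_
  filter_upwards [(memLp_ofReal_exp 𝕜 l t₀ t₁).coeFn_toLp] with t ht
  rw [expLp, ht, RCLike.inner_apply, RCLike.conj_ofReal]

end ExpLp

/-! ### Solutions of the evolution equation -/

/-- Self-adjointness moves `L` to the eigenfunction, so that the equation decouples. -/
theorem IsSimpleEigensystem.inner_apply {𝕜 : Type*} [RCLike 𝕜] {Ω : Type*} [MeasurableSpace Ω]
    {m : Measure Ω} {L : Lp 𝕜 2 m →ₗ.[𝕜] Lp 𝕜 2 m} {μ : ℕ → ℝ}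
    {φ : HilbertBasis ℕ 𝕜 (Lp 𝕜 2 m)} (hL : IsSimpleEigensystem L μ φ) (n : ℕ) (v : L.domain) :
    inner 𝕜 (φ n) (L v) = (μ n : 𝕜) * inner 𝕜 (φ n) (v : Lp 𝕜 2 m) := by
  have hfa := LinearPMap.adjoint_isFormalAdjoint hL.selfAdjoint.dense_domain
  rw [LinearPMap.isSelfAdjoint_def.1 hL.selfAdjoint] at hfa
  obtain ⟨hn, hLn⟩ := hL.eigen n
  have h1 := hfa ⟨φ n, hn⟩ v
  rw [hLn, inner_smul_left, RCLike.conj_ofReal] at h1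
  exact h1.symm

/-- In the basis of eigenfunctions, the solution is `∑ cₙ e^{-μₙ t} φₙ`. -/
theorem IsEvolutionSolution.repr_apply {𝕜 : Type*} [RCLike 𝕜] {Ω : Type*} [MeasurableSpace Ω]
    {m : Measure Ω} {L : Lp 𝕜 2 m →ₗ.[𝕜] Lp 𝕜 2 m} {μ : ℕ → ℝ}
    {φ : HilbertBasis ℕ 𝕜 (Lp 𝕜 2 m)} (hL : IsSimpleEigensystem L μ φ) {c : ℕ → 𝕜}
    {u : ℝ → Lp 𝕜 2 m} (hu : IsEvolutionSolution L φ c u) (n : ℕ) {t : ℝ} (ht : 0 < t) :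
    φ.repr (u t) n = c n * ((Real.exp (-(μ n) * t) : ℝ) : 𝕜) := by
  set G : ℝ → 𝕜 := fun t => φ.repr (u t) n * ((Real.exp (μ n * t) : ℝ) : 𝕜) with hG
  have hderiv : ∀ x, 0 < x → HasDerivAt G 0 x := by
    intro x hx
    obtain ⟨hdom, hux⟩ := hu.equation x hx
    have h1 : HasDerivAt (fun t => φ.repr (u t) n)
        (-((μ n : 𝕜) * φ.repr (u x) n)) x := by
      simp only [HilbertBasis.repr_apply_apply]
      have h2 := (hasDerivAt_const x (φ n)).inner 𝕜 hux
      rw [inner_zero_left, add_zero, inner_neg_right, hL.inner_apply] at h2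
      exact h2
    have h3 : HasDerivAt (fun t : ℝ => ((Real.exp (μ n * t) : ℝ) : 𝕜))
        (((Real.exp (μ n * x) * μ n : ℝ)) : 𝕜) x := by
      have h4 : HasDerivAt (fun t : ℝ => Real.exp (μ n * t)) (Real.exp (μ n * x) * μ n) x := by
        simpa using ((hasDerivAt_id x).const_mul (μ n)).exp
      exact (RCLike.ofRealCLM (K := 𝕜)).hasFDerivAt.comp_hasDerivAt x h4
    refine (h1.mul h3).congr_deriv ?_
    push_cast
    ring
  have hconst : ∀ x, 0 < x → G x = G t := fun x hx =>
    isOpen_Ioi.is_const_of_deriv_eq_zero isPreconnected_Ioi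
      (fun y hy => (hderiv y hy).differentiableAt.differentiableWithinAt)
      (fun y hy => (hderiv y hy).deriv) (mem_Ioi.2 hx) (mem_Ioi.2 ht)
  have hlim : Tendsto G (𝓝[>] 0) (𝓝 (c n)) := by
    have h1 : Tendsto (fun t : ℝ => ((Real.exp (μ n * t) : ℝ) : 𝕜)) (𝓝[>] 0) (𝓝 1) := by
      have h2 : Continuous fun t : ℝ => ((Real.exp (μ n * t) : ℝ) : 𝕜) :=
        RCLike.continuous_ofReal.comp (by fun_prop)
      simpa using (h2.tendsto 0).mono_left nhdsWithin_le_nhds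
    simpa using (hu.initial n).mul h1
  have hGt : G t = c n := by
    refine tendsto_nhds_unique (tendsto_const_nhds.congr' ?_) hlim
    filter_upwards [self_mem_nhdsWithin] with x hx using (hconst x hx).symm
  rw [← hGt, hG, mul_assoc, ← RCLike.ofReal_mul, ← Real.exp_add]
  simp

theorem IsEvolutionSolution.norm_le {𝕜 : Type*} [RCLike 𝕜] {Ω : Type*} [MeasurableSpace Ω]
    {m : Measure Ω} {L : Lp 𝕜 2 m →ₗ.[𝕜] Lp 𝕜 2 m} {μ : ℕ → ℝ}
    {φ : HilbertBasis ℕ 𝕜 (Lp 𝕜 2 m)} (hL : IsSimpleEigensystem L μ φ) {c : ℕ → 𝕜}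
    {u : ℝ → Lp 𝕜 2 m} (hu : IsEvolutionSolution L φ c u) (hc : Summable fun n => ‖c n‖ ^ 2)
    {t : ℝ} (ht : 0 < t) : ‖u t‖ ≤ Real.sqrt (∑' n, ‖c n‖ ^ 2) := by
  apply Real.le_sqrt_of_sq_le
  have hterm : ∀ n, ‖φ.repr (u t) n‖ ^ 2 ≤ ‖c n‖ ^ 2 := by
    intro n
    rw [hu.repr_apply hL n ht, norm_mul, RCLike.norm_ofReal, Real.abs_exp]
    refine pow_le_pow_left₀ (by positivity) (mul_le_of_le_one_right (norm_nonneg _) ?_) 2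
    rw [Real.exp_le_one_iff]
    nlinarith [hL.pos n]
  have h1 : ‖u t‖ ^ 2 = ∑' n, ‖φ.repr (u t) n‖ ^ 2 := by
    rw [← φ.repr.norm_map]
    have := lp.norm_rpow_eq_tsum (p := 2) (by norm_num) (φ.repr (u t))
    simpa using this
  rw [h1]
  exact (Summable.of_nonneg_of_le (fun n => by positivity) hterm hc).tsum_le_tsum hterm hc

theorem IsEvolutionSolution.memLp {𝕜 : Type*} [RCLike 𝕜] {Ω : Type*} [MeasurableSpace Ω]
    {m : Measure Ω} {L : Lp 𝕜 2 m →ₗ.[𝕜] Lp 𝕜 2 m} {μ : ℕ → ℝ}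
    {φ : HilbertBasis ℕ 𝕜 (Lp 𝕜 2 m)} (hL : IsSimpleEigensystem L μ φ) {c : ℕ → 𝕜}
    {u : ℝ → Lp 𝕜 2 m} (hu : IsEvolutionSolution L φ c u) (hc : Summable fun n => ‖c n‖ ^ 2)
    {t₀ t₁ : ℝ} (ht₀ : 0 ≤ t₀) : MemLp u 2 (volume.restrict (Icc t₀ t₁)) := by
  -- the value of `u` at `0` is arbitrary
  rw [Measure.restrict_congr_set Ioc_ae_eq_Icc.symm]
  have hpos : ∀ t ∈ Ioc t₀ t₁, 0 < t := fun t ht => ht₀.trans_lt ht.1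
  have hcont : ContinuousOn u (Ioc t₀ t₁) := fun t ht => by
    obtain ⟨_, h⟩ := hu.equation t (hpos t ht)
    exact h.continuousAt.continuousWithinAt
  refine MemLp.of_bound (hcont.aestronglyMeasurable measurableSet_Ioc)
    (Real.sqrt (∑' n, ‖c n‖ ^ 2)) ?_
  filter_upwards [ae_restrict_mem measurableSet_Ioc] with t ht
  exact hu.norm_le hL hc (hpos t ht)

/-! ### The moment problem -/

/-- Testing with the eigenfunctions, representing `v` by an average of `u` is a moment problem. -/
theorem IsEvolutionSolution.eq_integral_smul {𝕜 : Type*} [RCLike 𝕜] {Ω : Type*}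
    [MeasurableSpace Ω] {m : Measure Ω} {L : Lp 𝕜 2 m →ₗ.[𝕜] Lp 𝕜 2 m} {μ : ℕ → ℝ}
    {φ : HilbertBasis ℕ 𝕜 (Lp 𝕜 2 m)} (hL : IsSimpleEigensystem L μ φ) {c : ℕ → 𝕜}
    {u : ℝ → Lp 𝕜 2 m} (hu : IsEvolutionSolution L φ c u) {t₀ t₁ : ℝ} (ht₀ : 0 ≤ t₀)
    (hmem : MemLp u 2 (volume.restrict (Icc t₀ t₁)))
    (ν : Lp 𝕜 2 (volume.restrict (Icc t₀ t₁))) {v : Lp 𝕜 2 m}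
    (hν : ∀ n, c n * inner 𝕜 (expLp 𝕜 t₀ t₁ (μ n)) ν = φ.repr v n) :
    IntegrableOn (fun t => ν t • u t) (Icc t₀ t₁) ∧ v = ∫ t in Icc t₀ t₁, ν t • u t := by
  have hint : IntegrableOn (fun t => ν t • u t) (Icc t₀ t₁) :=
    memLp_one_iff_integrable.1 (hmem.smul (Lp.memLp ν))
  refine ⟨hint, φ.repr.injective (lp.ext (funext fun n => ?_))⟩
  rw [← hν n, inner_expLp, φ.repr_apply_apply, ← integral_inner hint, ← integral_const_mul,
    integral_Icc_eq_integral_Ioc, integral_Icc_eq_integral_Ioc]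
  refine setIntegral_congr_fun measurableSet_Ioc fun t ht => ?_
  rw [inner_smul_right, ← φ.repr_apply_apply, hu.repr_apply hL n (ht₀.trans_lt ht.1)]
  ring

/-- The solution of the moment problem as a series in a biorthogonal sequence. -/
theorem inner_tsum_biorthogonal {𝕜 E : Type*} [RCLike 𝕜] [NormedAddCommGroup E]
    [InnerProductSpace 𝕜 E] [CompleteSpace E] {e q : ℕ → E} {z : ℕ → 𝕜}
    (hq : ∀ k n, inner 𝕜 (e k) (q n) = if k = n then 1 else 0)
    (hz : Summable fun n => z n • q n) (k : ℕ) : inner 𝕜 (e k) (∑' n, z n • q n) = z k := by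
  have h1 := (innerSL 𝕜 (e k)).map_tsum hz
  simp only [innerSL_apply_apply] at h1
  rw [h1, tsum_eq_single k]
  · rw [inner_smul_right, hq, if_pos rfl, mul_one]
  · intro n hn
    rw [inner_smul_right, hq, if_neg hn.symm, mul_zero]

theorem summable_and_tsum_norm_repr_mul_le {𝕜 E : Type*} [RCLike 𝕜] [NormedAddCommGroup E]
    [InnerProductSpace 𝕜 E] (φ : HilbertBasis ℕ 𝕜 E) (f : E) {W : ℕ → ℝ} (hW : ∀ n, 0 ≤ W n)
    (hWs : Summable fun n => W n ^ 2) :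
    Summable (fun n => ‖φ.repr f n‖ * W n) ∧
      ∑' n, ‖φ.repr f n‖ * W n ≤ ‖f‖ * Real.sqrt (∑' n, W n ^ 2) := by
  have hf := lp.hasSum_norm (p := 2) (by norm_num) (φ.repr f)
  rw [φ.repr.norm_map] at hf
  simp only [ENNReal.toReal_ofNat, Real.rpow_ofNat] at hf
  have h := Real.summable_and_inner_le_Lp_mul_Lq_tsum_of_nonneg Real.HolderConjugate.two_two
    (f := fun n => ‖φ.repr f n‖) (g := W) (fun n => norm_nonneg _) hW
    (by simpa using hf.summable) (by simpa using hWs)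
  refine ⟨h.1, h.2.trans (le_of_eq ?_)⟩
  simp only [Real.rpow_ofNat, hf.tsum_eq]
  rw [← Real.sqrt_eq_rpow, ← Real.sqrt_eq_rpow, Real.sqrt_sq (norm_nonneg _)]

/-! ### Cost of the moment problem -/

theorem inv_expWeight_le_expDist {μ : ℕ → ℝ} (hpos : ∀ n, 0 < μ n) {K b : ℝ}
    (hcoeff : ∀ (a : ℕ →₀ ℝ) (n : ℕ),
      |a n| ≤ expWeight μ K b n * Real.sqrt (∫ t in Ici (0 : ℝ), expSum μ a t ^ 2)) (n : ℕ) :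
    (expWeight μ K b n)⁻¹ ≤ expDist μ (Ici 0) n := by
  refine le_expDist fun a ha => ?_
  rw [inv_le_iff_one_le_mul₀' (expWeight_pos hpos K b n)]
  simpa [ha] using hcoeff a n

/-- The sequence `W` bounds the cost `e^{p n^α - μₙ h} / dₙ(∞)` of the `n`-th moment, with `h` in the
role of `τ - t₀`. It is square summable for every `h > 0`, with an explicit blow-up as `h → 0`. -/
theorem exists_cost_sequence {μ : ℕ → ℝ} {M β σ θ s : ℝ} (hpos : ∀ n, 0 < μ n)
    (hmono : StrictMono μ) (hgrowth : EigenvalueGrowth μ M β σ) (hgap : EigenvalueGap μ θ s)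
    {p α b : ℝ} (hp : 0 ≤ p) (hαb : α ≤ b) (hb : 1 < b) (hbβ : b < β) :
    ∃ A : ℝ, 0 ≤ A ∧ ∀ h : ℝ, 0 < h → ∃ W : ℕ → ℝ, (∀ n, 0 ≤ W n) ∧
      (Summable fun n => W n ^ 2) ∧
      ∑' n, W n ^ 2 ≤ 4 / h * Real.exp (A * h ^ (-(b / (β - b)))) ∧
      ∀ n : ℕ, Real.exp (p * ((n : ℝ) + 1) ^ α) * Real.exp (-(μ n) * h) ≤
        expDist μ (Ici 0) n * W n := by
  obtain ⟨c, _, hc, -, hcμ⟩ := hgrowth.exists_two_sided_bound hpos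
  obtain ⟨K, hK, hcoeff⟩ := exists_abs_coeff_le hpos hmono hgrowth hgap hb
  obtain ⟨A, hA0, hA⟩ := exists_tsum_weight_le hpos hc (fun n => (hcμ n).1) hb.le hbβ
    (add_nonneg hK hp)
  refine ⟨A, hA0, fun h hh => ?_⟩
  set W : ℕ → ℝ := fun n => expWeight μ (K + p) b n * Real.exp (-(μ n) * h) with hW
  have hsq : ∀ n, W n ^ 2 =
      2 * μ n * Real.exp (2 * (K + p) * ((n : ℝ) + 1) ^ b - 2 * μ n * h) := by
    intro n
    rw [hW]
    simp only [expWeight]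
    rw [mul_pow, mul_pow, Real.sq_sqrt (by linarith [hpos n]), ← Real.exp_nat_mul,
      ← Real.exp_nat_mul, mul_assoc (2 * μ n) (Real.exp _), ← Real.exp_add]
    congr 2
    push_cast
    ring
  refine ⟨W, fun n => mul_nonneg (expWeight_pos hpos _ b n).le (Real.exp_pos _).le, ?_, ?_,
    fun n => ?_⟩
  · simpa only [hsq] using (hA h hh).1
  · simpa only [hsq] using (hA h hh).2
  · have h1 := inv_expWeight_le_expDist hpos hcoeff n
    have h2 : Real.exp (p * ((n : ℝ) + 1) ^ α) ≤ Real.exp (p * ((n : ℝ) + 1) ^ b) := by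
      apply Real.exp_le_exp.2
      exact mul_le_mul_of_nonneg_left
        (Real.rpow_le_rpow_of_exponent_le (by simp) hαb) hp
    have h3 : expWeight μ (K + p) b n =
        expWeight μ K b n * Real.exp (p * ((n : ℝ) + 1) ^ b) := by
      rw [expWeight, expWeight, mul_assoc, ← Real.exp_add, add_mul]
    have h4 := expWeight_pos hpos K b n
    calc Real.exp (p * ((n : ℝ) + 1) ^ α) * Real.exp (-(μ n) * h)
        ≤ Real.exp (p * ((n : ℝ) + 1) ^ b) * Real.exp (-(μ n) * h) := by gcongr
      _ = (expWeight μ K b n)⁻¹ * W n := by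
          rw [hW]; simp only [h3]; field_simp
      _ ≤ expDist μ (Ici 0) n * W n :=
          mul_le_mul_of_nonneg_right h1
            (mul_nonneg (expWeight_pos hpos _ b n).le (Real.exp_pos _).le)

/-- For `h ≤ r < 1`, the logarithm of `1 / h` is bounded away from `0`, which turns
`exp (A h^{-γ})` into a power of `h` with exponent of order `h^{-γ}`. -/
theorem exists_sqrt_exp_le_rpow {A γ : ℝ} (hA : 0 ≤ A) (hγ : 0 ≤ γ) {r : ℝ} (hr : r < 1) :
    ∃ ϖ : ℝ, ∀ h : ℝ, 0 < h → h ≤ r →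
      Real.sqrt (4 / h * Real.exp (A * h ^ (-γ))) ≤
        1 / Real.sqrt 2 * h ^ (-(1 + ϖ * h ^ (-γ)) / 2) := by
  refine ⟨(A + 3) / -Real.log r, fun h hh hhr => ?_⟩
  have hr0 : 0 < r := hh.trans_le hhr
  have hlr : 0 < -Real.log r := neg_pos.2 (Real.log_neg hr0 hr)
  have hlh : -Real.log r ≤ -Real.log h := neg_le_neg (Real.log_le_log hh hhr)
  have hg : 1 ≤ h ^ (-γ) :=
    Real.one_le_rpow_of_pos_of_le_one_of_nonpos hh (hhr.trans hr.le) (by linarith)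
  set G := h ^ (-γ)
  set ϖ := (A + 3) / -Real.log r with hϖ
  have hϖl : A + 3 ≤ ϖ * -Real.log h := by
    rw [hϖ, div_mul_eq_mul_div, le_div_iff₀ hlr]
    exact mul_le_mul_of_nonneg_left hlh (by linarith)
  have h1 : A * G + 3 ≤ ϖ * G * -Real.log h := by
    nlinarith [mul_le_mul_of_nonneg_left hϖl (by linarith : 0 ≤ G)]
  have h2 : (1 / Real.sqrt 2 * h ^ (-(1 + ϖ * G) / 2)) ^ 2 =
      1 / 2 * (1 / h * Real.exp (ϖ * G * -Real.log h)) := by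
    rw [mul_pow, div_pow, Real.sq_sqrt two_pos.le, one_pow, ← Real.rpow_natCast,
      ← Real.rpow_mul hh.le]
    congr 1
    rw [show -(1 + ϖ * G) / 2 * ((2 : ℕ) : ℝ) = -1 + -(ϖ * G) by push_cast; ring,
      Real.rpow_add hh, Real.rpow_neg_one, Real.rpow_def_of_pos hh, one_div]
    congr 2
    ring
  apply Real.sqrt_le_iff.2 ⟨by positivity, ?_⟩
  rw [h2]
  have h3 : (8 : ℝ) ≤ Real.exp 3 := by
    have : Real.exp 3 = Real.exp 1 ^ 3 := by rw [← Real.exp_nat_mul]; norm_num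
    rw [this]
    have h4 : (2 : ℝ) ≤ Real.exp 1 := by linarith [Real.exp_one_gt_d9]
    calc (8 : ℝ) = 2 ^ 3 := by norm_num
      _ ≤ _ := pow_le_pow_left₀ two_pos.le h4 3
  calc 4 / h * Real.exp (A * G) = 1 / 2 * (1 / h * (8 * Real.exp (A * G))) := by ring
    _ ≤ 1 / 2 * (1 / h * (Real.exp 3 * Real.exp (A * G))) := by gcongr
    _ = 1 / 2 * (1 / h * Real.exp (A * G + 3)) := by rw [← Real.exp_add, add_comm]
    _ ≤ _ := by gcongr

/-- The bound of `exists_cost_sequence` in the form of a power of `h`, with `ϖ` independent of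
`h ≤ r`. -/
theorem exists_cost_bound {μ : ℕ → ℝ} {M β σ θ s : ℝ} (hpos : ∀ n, 0 < μ n)
    (hmono : StrictMono μ) (hgrowth : EigenvalueGrowth μ M β σ) (hgap : EigenvalueGap μ θ s)
    {p α : ℝ} (hp : 0 ≤ p) {δ r : ℝ} (hδ : 0 < δ) (hδβ : δ < β - max α 1) (hr : r < 1) :
    ∃ ϖ : ℝ, ∀ h : ℝ, 0 < h → h ≤ r → ∃ W : ℕ → ℝ, (∀ n, 0 ≤ W n) ∧
      (Summable fun n => W n ^ 2) ∧
      Real.sqrt (∑' n, W n ^ 2) ≤ 1 / Real.sqrt 2 * h ^ (-(omegaExp α β δ ϖ h) / 2) ∧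
      ∀ n : ℕ, Real.exp (p * ((n : ℝ) + 1) ^ α) * Real.exp (-(μ n) * h) ≤
        expDist μ (Ici 0) n * W n := by
  have hβ : 1 < β := hgrowth.2.1
  have ha1 : 1 ≤ max α 1 := le_max_right _ _
  have haα : α ≤ max α 1 := le_max_left _ _
  set a := max α 1 with ha
  have hβδ : 0 < β - δ := by linarith
  -- the exponent `b` is chosen such that `b / (β - b) = a / (β - a - δ)`
  set b := a * β / (β - δ) with hb
  have hab : a < b := by rw [hb, lt_div_iff₀ hβδ]; nlinarith
  have hbβ : b < β := by rw [hb, div_lt_iff₀ hβδ]; nlinarith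
  have hγ : b / (β - b) = a / (β - a - δ) := by
    rw [div_eq_div_iff (by linarith) (by linarith), hb]
    field_simp
    ring
  obtain ⟨A, hA0, hA⟩ := exists_cost_sequence hpos hmono hgrowth hgap hp (haα.trans hab.le)
    (ha1.trans_lt hab) hbβ
  rw [hγ] at hA
  obtain ⟨ϖ, hϖ⟩ := exists_sqrt_exp_le_rpow hA0
    (div_nonneg (by linarith) (by linarith) : 0 ≤ a / (β - a - δ)) hr
  refine ⟨ϖ, fun h hh hhr => ?_⟩
  obtain ⟨W, hW0, hWs, hWle, hWd⟩ := hA h hh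
  exact ⟨W, hW0, hWs, (Real.sqrt_le_sqrt hWle).trans (hϖ h hh hhr), hWd⟩

/-- One term of the series for `ν`: `c`, `x` and `l` stand for `cₙ`, `fₙ` and `μₙ`, the distances
`dₙ(t₁ - t₀)` and `dₙ(∞)` are `d` and `d'`, and `P` is `p n^α`. -/
theorem norm_moment_smul_le {𝕜 E : Type*} [RCLike 𝕜] [NormedAddCommGroup E] [NormedSpace 𝕜 E]
    {C κ P l t₀ τ d d' W : ℝ} (hC : 0 < C) (hκ : 0 < κ) {c x : 𝕜} {q : E}
    (hc : C * Real.exp (-P) ≤ ‖c‖) (hd : 0 < d) (hdd : κ⁻¹ * d' ≤ d)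
    (hq : ‖q‖ ≤ Real.exp (l * t₀) * d⁻¹) (hW : 0 ≤ W)
    (hPW : Real.exp P * Real.exp (-l * (τ - t₀)) ≤ d' * W) :
    ‖(x / c * ((Real.exp (-l * τ) : ℝ) : 𝕜)) • q‖ ≤ κ / C * (‖x‖ * W) := by
  rw [norm_smul, norm_mul, norm_div, RCLike.norm_ofReal, Real.abs_exp]
  have h1 : ‖x‖ / ‖c‖ ≤ ‖x‖ / C * Real.exp P := by
    calc ‖x‖ / ‖c‖ ≤ ‖x‖ / (C * Real.exp (-P)) := by gcongr
      _ = _ := by rw [Real.exp_neg]; field_simp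
  have h2 : d' ≤ κ * d := by rwa [inv_mul_le_iff₀ hκ] at hdd
  calc ‖x‖ / ‖c‖ * Real.exp (-l * τ) * ‖q‖
      ≤ (‖x‖ / C * Real.exp P) * Real.exp (-l * τ) * (Real.exp (l * t₀) * d⁻¹) := by gcongr
    _ = ‖x‖ / C * d⁻¹ * (Real.exp P * Real.exp (-l * (τ - t₀))) := by
        rw [show -l * (τ - t₀) = -l * τ + l * t₀ by ring, Real.exp_add]; ring
    _ ≤ ‖x‖ / C * d⁻¹ * (κ * d * W) :=
        mul_le_mul_of_nonneg_left (hPW.trans (mul_le_mul_of_nonneg_right h2 hW)) (by positivity)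
    _ = κ / C * (‖x‖ * W) := by field_simp

/-! ### Representation of one solution by averages of another -/

theorem mainTheorem1 {𝕜 : Type*} [RCLike 𝕜] {Ω : Type*} [MeasurableSpace Ω] {m : Measure Ω}
    (L : Lp 𝕜 2 m →ₗ.[𝕜] Lp 𝕜 2 m) (μ : ℕ → ℝ) (φ : HilbertBasis ℕ 𝕜 (Lp 𝕜 2 m))
    (hL : IsSimpleEigensystem L μ φ)
    {M β σ θ s : ℝ} (hgrowth : EigenvalueGrowth μ M β σ) (hgap : EigenvalueGap μ θ s) :
    (∀ T : ℝ, 0 < T → ∃ κ : ℝ, IsDistComparison μ T κ) ∧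
    ∀ p α : ℝ, 0 ≤ p → 0 ≤ α → α < β →
      -- `ϖ` depends on `δ`, on the upper bound `r` for `τ - t₀`, on `p`, `α` and the spectrum
      ∃ ϖ : ℝ → ℝ → ℝ,
        ∀ (C : ℝ) (c : ℕ → 𝕜) (u : ℝ → Lp 𝕜 2 m) (f : Lp 𝕜 2 m) (w : ℝ → Lp 𝕜 2 m)
          (t₀ t₁ τ : ℝ),
          0 < C → (∀ n : ℕ, C * Real.exp (-p * ((n : ℝ) + 1) ^ α) ≤ ‖c n‖) →
          IsEvolutionSolution L φ c u →
          IsEvolutionSolution L φ (fun n => φ.repr f n) w →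
          0 ≤ t₀ → t₀ < t₁ → t₀ < τ →
          -- the sample datum is in `L²(Ω)` or, more generally, `u` is in `L²(t₀, t₁; L²(Ω))`
          ((Summable fun n => ‖c n‖ ^ 2) ∨ MemLp u 2 (volume.restrict (Icc t₀ t₁))) →
          ∃ ν : Lp 𝕜 2 (volume.restrict (Icc t₀ t₁)),
            IntegrableOn (fun t => ν t • u t) (Icc t₀ t₁) ∧
            w τ = ∫ t in Icc t₀ t₁, ν t • u t ∧
            ∀ δ r κ : ℝ, 0 < δ → δ < β - max α 1 → r < 1 → τ - t₀ ≤ r →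
              IsDistComparison μ (t₁ - t₀) κ →
              ‖ν‖ ≤ 1 / (Real.sqrt 2 * C) * κ * ‖f‖ *
                (τ - t₀) ^ (-(omegaExp α β δ (ϖ δ r) (τ - t₀)) / 2) := by

  have hpos := hL.pos
  have hmono := hL.strictMono
  have hβ : 1 < β := hgrowth.2.1
  have hcomp : ∀ T : ℝ, 0 < T → ∃ κ : ℝ, IsDistComparison μ T κ := by
    intro T hT
    obtain ⟨c, _, hc, -, hcμ⟩ := hgrowth.exists_two_sided_bound hpos
    -- any exponent between `1` and `β` serves here
    have hb : 1 < (1 + β) / 2 := by linarith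
    obtain ⟨K, hK, hcoeff⟩ := exists_abs_coeff_le hpos hmono hgrowth hgap hb
    exact exists_isDistComparison hpos hmono hcoeff (fun t ht => summable_expWeight_mul_exp hpos
      hmono hc (fun n => (hcμ n).1) hb.le (by linarith) hK ht) hT
  refine ⟨hcomp, fun p α hp hα hαβ => ?_⟩
  have hmax : max α 1 < β := max_lt hαβ hβ
  have hcost : ∀ δ r : ℝ, ∃ ϖ : ℝ, 0 < δ → δ < β - max α 1 → r < 1 →
      ∀ h : ℝ, 0 < h → h ≤ r → ∃ W : ℕ → ℝ, (∀ n, 0 ≤ W n) ∧ (Summable fun n => W n ^ 2) ∧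
        Real.sqrt (∑' n, W n ^ 2) ≤ 1 / Real.sqrt 2 * h ^ (-(omegaExp α β δ ϖ h) / 2) ∧
        ∀ n : ℕ, Real.exp (p * ((n : ℝ) + 1) ^ α) * Real.exp (-(μ n) * h) ≤
          expDist μ (Ici 0) n * W n := by
    intro δ r
    by_cases hcond : 0 < δ ∧ δ < β - max α 1 ∧ r < 1
    · obtain ⟨ϖ, hϖ⟩ := exists_cost_bound hpos hmono hgrowth hgap hp hcond.1 hcond.2.1 hcond.2.2
      exact ⟨ϖ, fun _ _ _ => hϖ⟩
    · exact ⟨0, fun h1 h2 h3 => absurd ⟨h1, h2, h3⟩ hcond⟩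
  choose ϖ hϖ using hcost
  refine ⟨ϖ, fun C c u f w t₀ t₁ τ hC hc hu hw ht₀ h01 hτ hdata => ?_⟩
  have hmem : MemLp u 2 (volume.restrict (Icc t₀ t₁)) :=
    hdata.elim (fun h => hu.memLp hL h ht₀) id
  -- a cost sequence for `τ - t₀` of any size, which makes the series for `ν` converge
  obtain ⟨W₀, hW₀, hW₀s, hW₀d⟩ : ∃ W : ℕ → ℝ, (∀ n, 0 ≤ W n) ∧ (Summable fun n => W n ^ 2) ∧
      ∀ n : ℕ, Real.exp (p * ((n : ℝ) + 1) ^ α) * Real.exp (-(μ n) * (τ - t₀)) ≤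
        expDist μ (Ici 0) n * W n := by
    obtain ⟨b, hb1, hb2⟩ := exists_between hmax
    obtain ⟨A, -, hA⟩ := exists_cost_sequence hpos hmono hgrowth hgap hp
      ((le_max_left _ _).trans hb1.le) ((le_max_right _ _).trans_lt hb1) hb2
    obtain ⟨W, h1, h2, -, h3⟩ := hA (τ - t₀) (sub_pos.2 hτ)
    exact ⟨W, h1, h2, h3⟩
  obtain ⟨κ₀, hκ₀⟩ := hcomp (t₁ - t₀) (sub_pos.2 h01)
  have hd : ∀ n, 0 < expDist μ (Icc 0 (t₁ - t₀)) n := fun n =>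
    (mul_pos (inv_pos.2 hκ₀.1) (pos_of_mul_pos_left
      ((mul_pos (Real.exp_pos _) (Real.exp_pos _)).trans_le (hW₀d n)) (hW₀ n))).trans_le (hκ₀.2 n)
  obtain ⟨q, hq, hqe⟩ := exists_biorthogonal (𝕜 := 𝕜) μ h01.le hd
  set z : ℕ → 𝕜 := fun n => φ.repr f n / c n * ((Real.exp (-(μ n) * τ) : ℝ) : 𝕜) with hz
  have hterm : ∀ κ, IsDistComparison μ (t₁ - t₀) κ → ∀ W : ℕ → ℝ, (∀ n, 0 ≤ W n) →
      (∀ n : ℕ, Real.exp (p * ((n : ℝ) + 1) ^ α) * Real.exp (-(μ n) * (τ - t₀)) ≤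
        expDist μ (Ici 0) n * W n) →
      ∀ n, ‖z n • q n‖ ≤ κ / C * (‖φ.repr f n‖ * W n) := fun κ hκ W hW hWd n =>
    norm_moment_smul_le hC hκ.1 (by simpa only [neg_mul] using hc n) (hd n) (hκ.2 n) (hq n) (hW n)
      (hWd n)
  have hzs : Summable fun n => ‖z n • q n‖ :=
    Summable.of_nonneg_of_le (fun n => norm_nonneg _) (hterm κ₀ hκ₀ W₀ hW₀ hW₀d)
      ((summable_and_tsum_norm_repr_mul_le φ f hW₀ hW₀s).1.mul_left _)
  have hν : ∀ n, c n * inner 𝕜 (expLp 𝕜 t₀ t₁ (μ n)) (∑' n, z n • q n) = φ.repr (w τ) n := by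
    intro n
    have hcn : c n ≠ 0 := norm_pos_iff.1
      ((mul_pos hC (Real.exp_pos _)).trans_le (hc n))
    rw [inner_tsum_biorthogonal hqe hzs.of_norm, hw.repr_apply hL n (ht₀.trans_lt hτ), hz]
    field_simp
  obtain ⟨hint, heq⟩ := hu.eq_integral_smul hL ht₀ hmem _ hν
  refine ⟨∑' n, z n • q n, hint, heq, fun δ r κ hδ hδβ hr hτr hκ => ?_⟩
  obtain ⟨W, hW, hWs, hWle, hWd⟩ := hϖ δ r hδ hδβ hr (τ - t₀) (sub_pos.2 hτ) hτr
  obtain ⟨hfs, hfle⟩ := summable_and_tsum_norm_repr_mul_le φ f hW hWs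
  have hκC : 0 ≤ κ / C := div_nonneg hκ.1.le hC.le
  calc ‖∑' n, z n • q n‖ ≤ ∑' n, ‖z n • q n‖ := norm_tsum_le_tsum_norm hzs
    _ ≤ ∑' n, κ / C * (‖φ.repr f n‖ * W n) :=
        hzs.tsum_le_tsum (hterm κ hκ W hW hWd) (hfs.mul_left _)
    _ = κ / C * ∑' n, ‖φ.repr f n‖ * W n := tsum_mul_left
    _ ≤ κ / C * (‖f‖ * (1 / Real.sqrt 2 *
          (τ - t₀) ^ (-(omegaExp α β δ (ϖ δ r) (τ - t₀)) / 2))) :=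
        mul_le_mul_of_nonneg_left
          (hfle.trans (mul_le_mul_of_nonneg_left hWle (norm_nonneg _))) hκC
    _ = _ := by field_simp
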